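/- Let $d\in\{2,3\}$, let $\Omega\subset\mathbb R^d$ be a bounded open set (for instance a Lipschitz domain), and let $\mathcal T_h$ be a finite partition of $\overline\Omega$ into elements with disjoint interiors (triangles or convex quadrilaterals if $d=2$, tetrahedra or parallelepipeds if $d=3$; hanging nodes allowed). Its interior faces are the sets $F=K\cap K'$ ($K\ne K'$ in $\mathcal T_h$) of positive $(d-1)$-dimensional measure, its boundary faces are the edges/faces of elements contained in $\partial\Omega$; $\mathcal F_h$ is the set of all of them, $\mathcal F(K)=\{F\in\mathcal F_h: F\subset K\}$, these faces cover $\partial K$, and $h_F$ is the diameter of $F$. $P_\ell(D)$ denotes the polynomials on $D$ of total degree $\le\ell$ if $D$ is a simplex, and of degree $\le \ell$ in each variable (of fixed affine coordinates on $D$) otherwise. For $k\ge 0$ let $$\mathcal H_{1,h}=P_{k+1}(\mathcal T_h,\mathbb R^{d\times 3}),\quad \hat{\mathcal H}_{1,h}=\{[\hat v|\hat w|\hat s]\in P_{k+1}(\mathcal F_h,\mathbb R^{d\times3}) : \hat v=0 \text{ on boundary faces}\},\quad \mathcal H_{2,h}=P_k(\mathcal T_h,\mathbb R^{d\times d}_{\rm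 sym})\times P_k(\mathcal T_h)^2 .$$ Parameters: $\rho_s,\rho_f,\eta,\kappa,c_0,a_0,\chi,\tau>0$, $\phi\in(0,1)$, $\nu>1$, $\alpha\in(0,1]$, $\beta,b_0\in\mathbb R$ with $a_0c_0-b_0^2>0$; $\rho=\phi\rho_f+(1-\phi)\rho_s$, $\rho_w=\frac\nu\phi\rho_f$; $\mathcal C$ is a symmetric positive definite linear map of $\mathbb R^{d\times d}_{\rm sym}$ and $\mathcal A=\mathcal C^{-1}$. Put $R=\begin{pmatrix}\rho&\rho_f&0\\ \rho_f&\rho_w&0\\0&0&\tau/\chi\end{pmatrix}$, $Q=\begin{pmatrix}c_0&-b_0\\-b_0&a_0\end{pmatrix}$. For $\underline u=[u|q|r]$, $\underline v=[v|w|s]$, $\Theta=(\sigma,[p;\theta])$, $\Phi=(\tau,[z;\varphi])$ let $(\underline u,\underline v)_{\mathcal H_1}=(\underline uR,\underline v)_\Omega$, $(\Theta,\Phi)_{\mathcal H_2}=(\mathcal A\sigma,\tau)_\Omega+(Q[p;\theta],[z;\varphi])_\Omega$, $\mathfrak I\underline u=[0|\frac\eta\kappa q|\frac1\chi r]$, and,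 with $n$ the outward unit normal of each element and $\langle\cdot,\cdot\rangle_{\partial\mathcal T_h}=\sum_K\sum_{F\in\mathcal F(K)}\int_F$, $$B_h(\Phi,(\underline v,\hat{\underline v}))=(\tau-(\alpha z+\beta\varphi)I,\varepsilon(v))_{\mathcal T_h}-(z,\operatorname{div}w)_{\mathcal T_h}-(\varphi,\operatorname{div}s)_{\mathcal T_h}-\langle(\tau-(\alpha z+\beta\varphi)I)n,v-\hat v\rangle_{\partial\mathcal T_h}+\langle zn,w-\hat w\rangle_{\partial\mathcal T_h}+\langle\varphi n,s-\hat s\rangle_{\partial\mathcal T_h}.$$ Let $T>0$, $\underline F\in C([0,T];L^2(\Omega,\mathbb R^{d\times3}))$, $g\in C([0,T];L^2(\Omega))$, and let $\underline u^0$, $\sigma^0$ (symmetric), $p^0,\theta^0$ be square integrable. The semi-discrete HDG problem is: find $(\underline u_h,\hat{\underline u}_h)\in C^1([0,T];\mathcal H_{1,h}\times\hat{\mathcal H}_{1,h})$ and $\Theta_h=(\sigma_h,[p_h;\theta_h])\in C^1([0,T];\mathcal H_{2,h})$ such that, for all $t\in[0,T]$, $(\underline v,\hat{\underline v})\in\mathcal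 H_{1,h}\times\hat{\mathcal H}_{1,h}$ and $\Phi\in\mathcal H_{2,h}$, $$(\dot{\underline u}_h,\underline v)_{\mathcal H_1}+(\dot\Theta_h,\Phi)_{\mathcal H_2}+(\mathfrak I\underline u_h,\underline v)_\Omega+B_h(\Theta_h,(\underline v,\hat{\underline v}))-B_h(\Phi,(\underline u_h,\hat{\underline u}_h))+\langle\tfrac{(k+1)^2}{h_F}(\underline u_h-\hat{\underline u}_h),\underline v-\hat{\underline v}\rangle_{\partial\mathcal T_h}=(\underline F,\underline v)_\Omega+(g,\varphi)_\Omega,\tag{1}$$ and such that $\underline u_h(0)$ (degree $k+1$) and $\sigma_h(0),p_h(0),\theta_h(0)$ (degree $k$) are the elementwise $L^2$ projections of $\underline u^0,\sigma^0,p^0,\theta^0$. Then: 1. This problem has exactly one solution on $[0,T]$. 2. It is equivalent to the reduced problem for $(\underline u_h,\Theta_h)$ in which, at each $t\in[0,T]$, $\hat{\underline u}_h$ is the $L^2(\mathcal F_h)$-orthogonal projection onto $\hat{\mathcal H}_{1,h}$ of $$\{\underline u_h\}-\tfrac{h_F}{(k+1)^2}\big[\{(\sigma_h-(\alpha p_h+\beta\theta_h)I)n\}\,\big|\,-\{p_hn\}\,\big|\,-\{\theta_hn\}\big]\tag{2}$$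 ($\{\cdot\}$ is the mean over the elements adjacent to the face), (1) is imposed for all $\underline v,\Phi$ with $\hat{\underline v}=0$, the same initial conditions hold, and $C^1$ regularity in time is required of $\underline u_h,\Theta_h$ only. 3. For every $w\in L^2(\mathcal F_h,\mathbb R^{d\times3})$ (in particular the trace of $\underline u^0$ on the faces, when it exists), the solution also satisfies $\hat{\underline u}_h(0)=\Pi_{\mathcal F}^{k+1}w$, with $\Pi^{k+1}_{\mathcal F}$ the facewise $L^2$ projection onto degree $k+1$, exactly when the prescribed discrete initial values are consistent, that is, when $\Pi_{\mathcal F}^{k+1}w$ lies in $\hat{\mathcal H}_{1,h}$ and is the projection of (2) computed from the projected initial data. 4. The solution depends continuously on the data: there is a constant $C$, independent of $\underline F,g$ and of the initial data, such that for all $t\in[0,T]$ $$\|\underline u_h(t)\|_{\mathcal H_1}^2+\|\Theta_h(t)\|_{\mathcal H_2}^2\le C\big(\|\underline u^0\|^2+\|\sigma^0\|^2+\|p^0\|^2+\|\theta^0\|^2+m^2\big)$$ whenever the $L^2(\Omega)$ norms of $g(s)$ and of each column of $\underline F(s)$ are at most $m$ for all $s\in[0,T]$ (norms on the right are $L^2(\Omega)$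 norms). -/

import Mathlib

open MeasureTheory Set
open scoped RealInnerProductSpace

namespace ThermoHDG

/-! ### Geometry: elements, faces, meshes -/

/-- The space `ℝ^d` with its Euclidean structure. -/
abbrev Pt (d : ℕ) := EuclideanSpace ℝ (Fin d)

/-- `D` is a nondegenerate closed `n`-simplex (segment, triangle, tetrahedron for `n = 1, 2, 3`). -/
def IsSimplex {d : ℕ} (n : ℕ) (D : Set (Pt d)) : Prop :=
  ∃ p : Fin (n + 1) → Pt d, AffineIndependent ℝ p ∧ D = convexHull ℝ (range p)

/-- `K` is the convex hull of four points in convex position. -/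
def IsConvexQuadrilateral {d : ℕ} (K : Set (Pt d)) : Prop :=
  ∃ p : Fin 4 → Pt d, ConvexIndependent ℝ p ∧ K = convexHull ℝ (range p)

/-- `K` is a nondegenerate parallelepiped: an affine image of the unit cube. -/
def IsParallelepiped {d : ℕ} (K : Set (Pt d)) : Prop :=
  ∃ A : Pt d ≃ᵃ[ℝ] Pt d, K = A '' {x | ∀ i, x i ∈ Icc (0 : ℝ) 1}

/-- Admissible closed elements: triangles and quadrilaterals when `d = 2`, tetrahedra and
parallelepipeds when `d = 3`. -/
def IsElement {d : ℕ} (K : Set (Pt d)) : Prop :=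
  IsSimplex d K ∨ (d = 2 ∧ IsConvexQuadrilateral K) ∨ (d = 3 ∧ IsParallelepiped K)

/-- The `(d-1)`-dimensional surface measure on `ℝ^d`, normalised to agree with Lebesgue measure
on hyperplanes. -/
noncomputable def surf (d : ℕ) : Measure (Pt d) := Measure.euclideanHausdorffMeasure (d - 1)

/-- `F` is an edge (`d = 2`) or a face (`d = 3`) of the convex polytope `K`. -/
def IsFacet {d : ℕ} (K F : Set (Pt d)) : Prop :=
  0 < surf d F ∧ ∃ n : Pt d, ‖n‖ = 1 ∧ F = {x ∈ K | ∀ y ∈ K, ⟪n, y⟫ ≤ ⟪n, x⟫}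

/-- `F` is an interior edge/face of the partition `elems`. -/
def IsInteriorFace {d : ℕ} (elems : Finset (Set (Pt d))) (F : Set (Pt d)) : Prop :=
  0 < surf d F ∧ ∃ K ∈ elems, ∃ K' ∈ elems, K ≠ K' ∧ F = K ∩ K'

/-- `F` is a boundary edge/face of the partition `elems` of the closure of `Ω`. -/
def IsBoundaryFace {d : ℕ} (Ω : Set (Pt d)) (elems : Finset (Set (Pt d)))
    (F : Set (Pt d)) : Prop :=
  (∃ K ∈ elems, IsFacet K F) ∧ F ⊆ frontier Ω

/-- A partition of the closure of `Ω` into elements, hanging nodes being permitted, with the set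
of its interior and boundary faces.

The coordinates `elemCoord K`, `faceCoord F` are only used to say what "degree at most `ℓ` in each
variable" means when `K` or `F` is not a simplex. They may be any affine coordinates on `K`
(resp. on the hyperplane of `F`): the Cartesian coordinates, or the coordinates along the edges
of a parallelepiped or a parallelogram. -/
structure Mesh {d : ℕ} (Ω : Set (Pt d)) where
  elems : Finset (Set (Pt d))
  isElement : ∀ K ∈ elems, IsElement K
  cover : ⋃ K ∈ elems, K = closure Ω
  disjoint : ∀ K ∈ elems, ∀ K' ∈ elems, K ≠ K' → Disjoint (interior K) (interior K')
  faces : Finset (Set (Pt d))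
  mem_faces : ∀ F, F ∈ faces ↔ IsInteriorFace elems F ∨ IsBoundaryFace Ω elems F
  frontier_subset : ∀ K ∈ elems, frontier K ⊆ ⋃ F ∈ {F | F ∈ faces ∧ F ⊆ K}, F
  elemCoord : Set (Pt d) → (Pt d ≃ᵃ[ℝ] (Fin d → ℝ))
  faceCoord : Set (Pt d) → (Pt d →ᵃ[ℝ] (Fin (d - 1) → ℝ))
  faceCoord_injOn : ∀ F ∈ faces, InjOn (faceCoord F) (affineSpan ℝ F)

/-- The unit normal to the face `F` of the convex set `K`, outward from `K`. -/
noncomputable def outwardNormal {d : ℕ} (K F : Set (Pt d)) : Pt d :=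
  open Classical in
  if h : ∃ n : Pt d, ‖n‖ = 1 ∧ ∀ x ∈ K, ∀ y ∈ F, ⟪n, x - y⟫ ≤ 0 then h.choose else 0

/-! ### Piecewise polynomial spaces -/

/-- The function `x ↦ q (c x)` for a polynomial `q` and coordinates `c`. -/
noncomputable def evalCoord {d n : ℕ} (c : Pt d → Fin n → ℝ) :
    MvPolynomial (Fin n) ℝ →ₗ[ℝ] (Pt d → ℝ) :=
  LinearMap.pi fun x => (MvPolynomial.aeval (c x)).toLinearMap

/-- Multiplication by the characteristic function of `F`. -/
noncomputable def cutOff {d : ℕ} (F : Set (Pt d)) : (Pt d → ℝ) →ₗ[ℝ] (Pt d → ℝ) where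
  toFun f := F.indicator f
  map_add' f g := Set.indicator_add F f g
  map_smul' c f := Set.indicator_const_smul F c f

section Spaces

variable {d : ℕ} {Ω : Set (Pt d)}

/-- `P_ℓ(K)`: polynomials of total degree at most `ℓ` if `K` is a triangle or a tetrahedron, of
degree at most `ℓ` in each variable otherwise. As `K` has nonempty interior, a polynomial on `K` is
identified with its extension to `ℝ^d`. -/
noncomputable def Mesh.poly (M : Mesh Ω) (ℓ : ℕ) (K : Set (Pt d)) : Submodule ℝ (Pt d → ℝ) :=
  open Classical in
  if IsSimplex d K then
    (MvPolynomial.restrictTotalDegree (Fin d) ℝ ℓ).map (evalCoord (M.elemCoord K))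
  else
    (MvPolynomial.restrictDegree (Fin d) ℝ ℓ).map (evalCoord (M.elemCoord K))

/-- `P_ℓ(F)` for an edge/face `F`. A function on `F` is extended by zero to `ℝ^d`. -/
noncomputable def Mesh.facePoly (M : Mesh Ω) (ℓ : ℕ) (F : Set (Pt d)) :
    Submodule ℝ (Pt d → ℝ) :=
  open Classical in
  if IsSimplex (d - 1) F then
    (MvPolynomial.restrictTotalDegree (Fin (d - 1)) ℝ ℓ).map
      (cutOff F ∘ₗ evalCoord (M.faceCoord F))
  else
    (MvPolynomial.restrictDegree (Fin (d - 1)) ℝ ℓ).map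
      (cutOff F ∘ₗ evalCoord (M.faceCoord F))

/-- Real symmetric `d × d` matrices. -/
def Sym (d : ℕ) : Submodule ℝ (Matrix (Fin d) (Fin d) ℝ) where
  carrier := {A | A.IsSymm}
  add_mem' hA hB := Matrix.IsSymm.add hA hB
  zero_mem' := Matrix.isSymm_zero
  smul_mem' c _ hA := Matrix.IsSymm.smul hA c

/-- The Frobenius product `A : B`. -/
def frob (A B : Matrix (Fin d) (Fin d) ℝ) : ℝ := ∑ i, ∑ j, A i j * B i j

/-- A collection of elementwise and facewise functions
`([u | q | r], [û | q̂ | r̂], σ, p, θ)`; the index in `Fin 3` selects the column. -/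
@[ext]
structure HDGField (M : Mesh Ω) where
  vel : M.elems → Fin 3 → Pt d → Pt d
  velHat : M.faces → Fin 3 → Pt d → Pt d
  stress : M.elems → Pt d → Sym d
  pres : M.elems → Pt d → ℝ
  temp : M.elems → Pt d → ℝ

/-- The discrete space `H_{1,h} × Ĥ_{1,h} × H_{2,h}`: degree `k + 1` for the columns, elementwise
and facewise, with vanishing first face column on the boundary, and degree `k` for `(σ, p, θ)`. -/
structure HDGField.MemSpace {M : Mesh Ω} (k : ℕ) (X : HDGField M) : Prop where
  vel : ∀ (K : M.elems) (j : Fin 3) (i : Fin d), (fun x => X.vel K j x i) ∈ M.poly (k + 1) K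
  velHat : ∀ (F : M.faces) (j : Fin 3) (i : Fin d), (fun x => X.velHat F j x i) ∈ M.facePoly (k + 1) F
  velHat_boundary : ∀ F : M.faces, IsBoundaryFace Ω M.elems F → X.velHat F 0 = 0
  stress : ∀ (K : M.elems) (i j : Fin d), (fun x => (X.stress K x).1 i j) ∈ M.poly k K
  pres : ∀ K : M.elems, X.pres K ∈ M.poly k K
  temp : ∀ K : M.elems, X.temp K ∈ M.poly k K

/-- `g` is the `L²(μ)`-orthogonal projection of `f` onto `V`. -/
def IsL2Proj (μ : Measure (Pt d)) (V : Submodule ℝ (Pt d → ℝ)) (f g : Pt d → ℝ) : Prop :=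
  g ∈ V ∧ ∀ q ∈ V, ∫ x, (f x - g x) * q x ∂μ = 0

end Spaces

/-! ### Material parameters -/

structure Params (d : ℕ) where
  (rhoS rhoF phi nu eta kappa alpha beta c0 a0 b0 chi tau : ℝ)
  rhoS_pos : 0 < rhoS
  rhoF_pos : 0 < rhoF
  phi_mem : phi ∈ Ioo (0 : ℝ) 1
  nu_gt : 1 < nu
  eta_pos : 0 < eta
  kappa_pos : 0 < kappa
  alpha_mem : alpha ∈ Ioc (0 : ℝ) 1
  c0_pos : 0 < c0
  a0_pos : 0 < a0
  det_pos : 0 < a0 * c0 - b0 ^ 2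
  chi_pos : 0 < chi
  tau_pos : 0 < tau
  /-- The elasticity tensor `C`, acting on symmetric matrices. -/
  elast : Sym d →ₗ[ℝ] Sym d
  elast_symm : ∀ A B : Sym d, frob (elast A).1 B.1 = frob A.1 (elast B).1
  elast_bounds : ∃ cm cp : ℝ, 0 < cm ∧ cm < cp ∧ ∀ A : Sym d,
    cm * frob A.1 A.1 ≤ frob (elast A).1 A.1 ∧ frob (elast A).1 A.1 ≤ cp * frob A.1 A.1

namespace Params

variable {d : ℕ} (P : Params d)

/-- Composite density. -/
def rho : ℝ := P.phi * P.rhoF + (1 - P.phi) * P.rhoS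

/-- Added-mass coefficient. -/
noncomputable def rhoW : ℝ := P.nu / P.phi * P.rhoF

noncomputable def R : Matrix (Fin 3) (Fin 3) ℝ :=
  !![P.rho, P.rhoF, 0; P.rhoF, P.rhoW, 0; 0, 0, P.tau / P.chi]

def Q : Matrix (Fin 2) (Fin 2) ℝ := !![P.c0, -P.b0; -P.b0, P.a0]

theorem elast_injective : Function.Injective P.elast := by
  obtain ⟨cm, cp, h0, -, h⟩ := P.elast_bounds
  refine (injective_iff_map_eq_zero P.elast).2 fun A hA => ?_
  have h1 := (h A).1
  have h2 : frob (P.elast A).1 A.1 = 0 := by simp [hA, frob]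
  have h3 : frob A.1 A.1 ≤ 0 := by
    by_contra hc
    push Not at hc
    have := mul_pos h0 hc
    linarith
  have h4 : ∀ i ∈ Finset.univ, 0 ≤ ∑ j, A.1 i j * A.1 i j := fun i _ =>
    Finset.sum_nonneg fun j _ => mul_self_nonneg _
  have h5 : frob A.1 A.1 = 0 := le_antisymm h3 (Finset.sum_nonneg h4)
  ext i j
  have h6 := (Finset.sum_eq_zero_iff_of_nonneg h4).1 h5 i (Finset.mem_univ i)
  have h7 := (Finset.sum_eq_zero_iff_of_nonneg fun j _ => mul_self_nonneg _).1 h6 j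
    (Finset.mem_univ j)
  simpa using h7

/-- The compliance tensor `A = C⁻¹`. -/
noncomputable def compl : Sym d ≃ₗ[ℝ] Sym d :=
  (LinearEquiv.ofInjectiveEndo P.elast P.elast_injective).symm

end Params

/-! ### Differential operators and bilinear forms -/

section Forms

variable {d : ℕ} {Ω : Set (Pt d)} {M : Mesh Ω}

/-- The Jacobian matrix `(∂_j v_i)_{ij}`. -/
noncomputable def grad (v : Pt d → Pt d) (x : Pt d) : Matrix (Fin d) (Fin d) ℝ :=
  fun i j => (fderiv ℝ v x (EuclideanSpace.single j 1)) i

/-- The strain tensor `ε(v)`. -/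
noncomputable def strain (v : Pt d → Pt d) (x : Pt d) : Matrix (Fin d) (Fin d) ℝ :=
  (1 / 2 : ℝ) • (grad v x + (grad v x).transpose)

noncomputable def dvg (v : Pt d → Pt d) (x : Pt d) : ℝ := ∑ i, grad v x i i

/-- Matrix-vector product `S n`. -/
noncomputable def act (S : Matrix (Fin d) (Fin d) ℝ) (n : Pt d) : Pt d :=
  WithLp.toLp 2 (S.mulVec n.ofLp)

/-- `∑_K ∫_K f_K dx`. (`K` and `K ∩ Ω` differ by a part of `∂Ω`, where `L²(Ω)` data are not
defined.) -/
noncomputable def volSum (M : Mesh Ω) (f : M.elems → Pt d → ℝ) : ℝ :=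
  ∑ K : M.elems, ∫ x in K.1 ∩ Ω, f K x

/-- `∑_K ∑_{F ∈ F(K)} ∫_F f_{K,F} ds`. -/
noncomputable def bdrySum (M : Mesh Ω) (f : M.elems → M.faces → Pt d → ℝ) : ℝ :=
  open Classical in
  ∑ K : M.elems, ∑ F ∈ Finset.univ.filter (fun F : M.faces => F.1 ⊆ K.1), ∫ x in F.1, f K F x ∂(surf d)

/-- `∑_{F} ∫_F f_F ds`. -/
noncomputable def faceSum (M : Mesh Ω) (f : M.faces → Pt d → ℝ) : ℝ :=
  ∑ F : M.faces, ∫ x in F.1, f F x ∂(surf d)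

/-- The total stress `σ - (α p + β θ) I`. -/
def totalStress (P : Params d) (X : HDGField M) (K : M.elems) (x : Pt d) :
    Matrix (Fin d) (Fin d) ℝ :=
  (X.stress K x).1 - (P.alpha * X.pres K x + P.beta * X.temp K x) • (1 : Matrix (Fin d) (Fin d) ℝ)

/-- `(u, v)_{H₁} = (u R, v)_Ω`. -/
noncomputable def innerH1 (P : Params d) (X Y : HDGField M) : ℝ :=
  volSum M fun K x => ∑ j, ∑ l, P.R j l * ⟪X.vel K j x, Y.vel K l x⟫

/-- `(Θ, Φ)_{H₂} = (A σ, τ)_Ω + (Q [p; θ], [z; φ])_Ω`. -/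
noncomputable def innerH2 (P : Params d) (X Y : HDGField M) : ℝ :=
  volSum M fun K x => frob (P.compl (X.stress K x)).1 (Y.stress K x).1
    + P.Q.mulVec ![X.pres K x, X.temp K x] ⬝ᵥ ![Y.pres K x, Y.temp K x]

/-- `(I u, v)_Ω` with `I [u | q | r] = [0 | (η/κ) q | (1/χ) r]`. -/
noncomputable def damping (P : Params d) (X Y : HDGField M) : ℝ :=
  volSum M fun K x => P.eta / P.kappa * ⟪X.vel K 1 x, Y.vel K 1 x⟫
    + 1 / P.chi * ⟪X.vel K 2 x, Y.vel K 2 x⟫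

/-- `B_h(Φ, (v, v̂))`, with `Φ = (τ, [z; φ])` taken from `X` and `(v, v̂)` from `Y`. -/
noncomputable def formB (P : Params d) (X Y : HDGField M) : ℝ :=
  (volSum M fun K x => frob (totalStress P X K x) (strain (Y.vel K 0) x)
    - X.pres K x * dvg (Y.vel K 1) x - X.temp K x * dvg (Y.vel K 2) x)
  + bdrySum M fun K F x =>
      - ⟪act (totalStress P X K x) (outwardNormal K.1 F.1), Y.vel K 0 x - Y.velHat F 0 x⟫
      + ⟪X.pres K x • outwardNormal K.1 F.1, Y.vel K 1 x - Y.velHat F 1 x⟫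
      + ⟪X.temp K x • outwardNormal K.1 F.1, Y.vel K 2 x - Y.velHat F 2 x⟫

/-- The stabilization `⟨(k+1)²/h_F (u - û), v - v̂⟩_{∂T_h}`, `h_F` being the diameter of `F`. -/
noncomputable def stab (k : ℕ) (X Y : HDGField M) : ℝ :=
  bdrySum M fun K F x => ((k : ℝ) + 1) ^ 2 / Metric.diam F.1 *
    ∑ j, ⟪X.vel K j x - X.velHat F j x, Y.vel K j x - Y.velHat F j x⟫

/-- Left-hand side of the scheme at one time: trial state `X`, its time derivative `X'`,
test field `Y`. -/
noncomputable def schemeLHS (P : Params d) (k : ℕ) (X X' Y : HDGField M) : ℝ :=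
  innerH1 P X' Y + innerH2 P X' Y + damping P X Y + formB P X Y - formB P Y X + stab k X Y

end Forms

/-! ### Data, initial conditions, solutions -/

/-- Sources `F ∈ C([0,T]; L²(Ω; ℝ^{d×3}))` (by columns), `g ∈ C([0,T]; L²(Ω))` and square integrable
initial data, `σ⁰` being symmetric. -/
structure Data {d : ℕ} (Ω : Set (Pt d)) (T : ℝ) where
  F : ℝ → Fin 3 → Lp (Pt d) 2 (volume.restrict Ω)
  g : ℝ → Lp ℝ 2 (volume.restrict Ω)
  continuousOn_F : ContinuousOn F (Icc 0 T)
  continuousOn_g : ContinuousOn g (Icc 0 T)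
  vel0 : Fin 3 → Lp (Pt d) 2 (volume.restrict Ω)
  stress0 : Fin d → Fin d → Lp ℝ 2 (volume.restrict Ω)
  stress0_symm : ∀ i j, stress0 i j = stress0 j i
  pres0 : Lp ℝ 2 (volume.restrict Ω)
  temp0 : Lp ℝ 2 (volume.restrict Ω)

section Problem

variable {d : ℕ} {Ω : Set (Pt d)} {M : Mesh Ω} {T : ℝ}

/-- Right-hand side `(F(t), v)_Ω + (g(t), φ)_Ω`. -/
noncomputable def schemeRHS (D : Data Ω T) (t : ℝ) (Y : HDGField M) : ℝ :=
  volSum M fun K x => (∑ j, ⟪D.F t j x, Y.vel K j x⟫) + D.g t x * Y.temp K x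

/-- The volume components of `X` are the elementwise `L²` projections of the initial data. -/
structure IsVolumeInit (k : ℕ) (D : Data Ω T) (X : HDGField M) : Prop where
  vel : ∀ (K : M.elems) (j : Fin 3) (i : Fin d), IsL2Proj (volume.restrict (K.1 ∩ Ω)) (M.poly (k + 1) K)
    (fun x => D.vel0 j x i) (fun x => X.vel K j x i)
  stress : ∀ (K : M.elems) (i j : Fin d), IsL2Proj (volume.restrict (K.1 ∩ Ω)) (M.poly k K)
    (D.stress0 i j) (fun x => (X.stress K x).1 i j)
  pres : ∀ K : M.elems, IsL2Proj (volume.restrict (K.1 ∩ Ω)) (M.poly k K) D.pres0 (X.pres K)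
  temp : ∀ K : M.elems, IsL2Proj (volume.restrict (K.1 ∩ Ω)) (M.poly k K) D.temp0 (X.temp K)

/-- The face columns of `X` are the facewise `L²` projections of `w`. -/
def IsFaceInit (k : ℕ) (w : M.faces → Fin 3 → Pt d → Pt d) (X : HDGField M) : Prop :=
  ∀ (F : M.faces) (j : Fin 3) (i : Fin d), IsL2Proj ((surf d).restrict F.1) (M.facePoly (k + 1) F)
    (fun x => w F j x i) (fun x => X.velHat F j x i)

/-- The mean value on `F` of the traces from the elements adjacent to `F` (two for an interior face,
one for a boundary face). -/
noncomputable def faceMean (F : M.faces) (f : M.elems → Pt d) : Pt d :=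
  open Classical in
  ((Finset.univ.filter fun K : M.elems => F.1 ⊆ K.1).card : ℝ)⁻¹ •
    ∑ K : M.elems with F.1 ⊆ K.1, f K

/-- Columns of the face flux
`{u} - h_F/(k+1)² [ {(σ - (αp + βθ) I) n} | -{p n} | -{θ n} ]` on the face `F`. -/
noncomputable def faceFlux (P : Params d) (k : ℕ) (X : HDGField M) (F : M.faces) (x : Pt d) :
    Fin 3 → Pt d :=
  let c : ℝ := Metric.diam F.1 / ((k : ℝ) + 1) ^ 2
  ![faceMean F (fun K => X.vel K 0 x)
      - c • faceMean F (fun K => act (totalStress P X K x) (outwardNormal K.1 F.1)),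
    faceMean F (fun K => X.vel K 1 x)
      + c • faceMean F (fun K => X.pres K x • outwardNormal K.1 F.1),
    faceMean F (fun K => X.vel K 2 x)
      + c • faceMean F (fun K => X.temp K x • outwardNormal K.1 F.1)]

/-- The face columns of `X` are the `L²(F_h)`-orthogonal projection onto `Ĥ_{1,h}` of the face flux
computed from the volume components of `X`. (That they lie in `Ĥ_{1,h}` is part of `MemSpace`.) -/
def IsEliminated (P : Params d) (k : ℕ) (X : HDGField M) : Prop :=
  ∀ Y : HDGField M, Y.MemSpace k →
    faceSum M (fun F x => ∑ j, ⟪X.velHat F j x, Y.velHat F j x⟫)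
      = faceSum M (fun F x => ∑ j, ⟪faceFlux P k X F x j, Y.velHat F j x⟫)

/-- `f ∈ C¹([0,T])` with derivative `f'`. -/
def IsC1 (T : ℝ) (f f' : ℝ → ℝ) : Prop :=
  ContinuousOn f' (Icc 0 T) ∧ ∀ t ∈ Icc 0 T, HasDerivWithinAt f (f' t) (Icc 0 T) t

/-- The volume components of the curve `X` are `C¹` on `[0,T]`, with derivative given by `X'`.
(In a finite-dimensional space of functions, `C¹` curves are those that are `C¹` pointwise.) -/
structure IsC1Volume (T : ℝ) (X X' : ℝ → HDGField M) : Prop where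
  vel : ∀ K j x i, IsC1 T (fun t => (X t).vel K j x i) (fun t => (X' t).vel K j x i)
  stress : ∀ K x i j, IsC1 T (fun t => ((X t).stress K x).1 i j)
    (fun t => ((X' t).stress K x).1 i j)
  pres : ∀ K x, IsC1 T (fun t => (X t).pres K x) (fun t => (X' t).pres K x)
  temp : ∀ K x, IsC1 T (fun t => (X t).temp K x) (fun t => (X' t).temp K x)

/-- The face components of the curve `X` are `C¹` on `[0,T]`, with derivative given by `X'`. -/
def IsC1Face (T : ℝ) (X X' : ℝ → HDGField M) : Prop :=
  ∀ F j x i, IsC1 T (fun t => (X t).velHat F j x i) (fun t => (X' t).velHat F j x i)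

/-- `X = (u_h, û_h, Θ_h)`, a `C¹` curve in the discrete space, solves the semi-discrete HDG scheme
with projected initial data for `u_h` and `Θ_h`. -/
def IsSolution (P : Params d) (k : ℕ) (D : Data Ω T) (X : ℝ → HDGField M) : Prop :=
  (∀ t ∈ Icc 0 T, (X t).MemSpace k) ∧
  (∃ X' : ℝ → HDGField M, IsC1Volume T X X' ∧ IsC1Face T X X' ∧
    ∀ t ∈ Icc 0 T, ∀ Y : HDGField M, Y.MemSpace k →
      schemeLHS P k (X t) (X' t) Y = schemeRHS D t Y) ∧
  IsVolumeInit k D (X 0)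

/-- `(u_h, Θ_h)` solves the reduced ODE system on the volume spaces: `û_h` is the
projection of the face flux of `(u_h, Θ_h)`, and the scheme holds for all volume test functions.
Time regularity is required of the volume components only. -/
def IsReducedSolution (P : Params d) (k : ℕ) (D : Data Ω T) (X : ℝ → HDGField M) : Prop :=
  (∀ t ∈ Icc 0 T, (X t).MemSpace k ∧ IsEliminated P k (X t)) ∧
  (∃ X' : ℝ → HDGField M, IsC1Volume T X X' ∧
    ∀ t ∈ Icc 0 T, ∀ Y : HDGField M, Y.MemSpace k → Y.velHat = 0 →
      schemeLHS P k (X t) (X' t) Y = schemeRHS D t Y) ∧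
  IsVolumeInit k D (X 0)

end Problem

end ThermoHDG

/-!
The scheme is a linear differential-algebraic system in finite dimensions: the face columns carry
no time derivative. The proof eliminates them and treats what remains as a linear evolution
equation.

Write `V` for the discrete space (`HDGField.space`), `m` for the mass form `(·,·)_{H₁} +
(·,·)_{H₂}`, `a` for the remaining terms of the scheme, and `V̂ ⊆ V` for the pure face fields
(`hatSpace`). Testing with `V̂` and collecting the contributions of the elements adjacent to each
face turns `a(X, Y) = 0` into the weighted face residual of the elimination formula
(`steadyForm_hat`). The weights are positive constants on each face, so they can be absorbed into
the test function, and the space `Z` of all `X` with `a(X, Y) = 0` for every `Y ∈ V̂`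
(`elimSpace`) consists exactly of the fields whose face columns are the projected flux
(`isEliminated_iff`). On `V̂` the form `a` reduces to the stabilization, which is definite
(`eq_zero_of_steadyForm_hat`); hence `V = Z ⊕ V̂`, and a field of `Z` is determined by its volume
components.

Consequently the scheme and the reduced scheme are both equivalent to: `X(t) ∈ Z` and `m(X', Y) +
a(X, Y) = (load, Y)` for `Y ∈ Z`. Since volume point values separate the points of `Z`, every
functional on `Z` is a finite combination of them, so regularity of the volume components gives
regularity of the face columns (`exists_isC1Curve`). The matrices `R`, `Q` and the compliance
tensor are positive definite, so `m` has no isotropic vectors on `Z` (`mem_hatSpace_of_massForm`),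
and the equation is a linear ODE with continuous forcing: Duhamel's formula gives existence
(`exists_evolution`), Grönwall's inequality uniqueness and continuous dependence
(`exists_evolution_bound`). The initial values are bounded by the data because point evaluation of
a polynomial is an `L²` moment (`exists_representer`).

The definiteness statements rest on two facts about the mesh. An element meets `Ω` in a set with
nonempty interior, which determines polynomials. A face has positive finite surface measure and is
mapped by its coordinates onto a convex body of `ℝ^{d-1}` with comparable measure, so a face
polynomial vanishing almost everywhere vanishes (`Mesh.eqOn_zero_face_of_ae`).
-/

namespace ThermoHDG

/-! ### Elements and faces -/

section Geometry

variable {d : ℕ} {Ω : Set (Pt d)}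

theorem IsElement.isCompact {K : Set (Pt d)} (h : IsElement K) : IsCompact K := by
  rcases h with ⟨p, -, rfl⟩ | ⟨-, p, -, rfl⟩ | ⟨-, A, rfl⟩
  · exact (finite_range p).isCompact_convexHull ℝ
  · exact (finite_range p).isCompact_convexHull ℝ
  · refine IsCompact.image ?_ A.continuous_of_finiteDimensional
    have h1 : IsCompact (Set.univ.pi fun _ : Fin d => Icc (0 : ℝ) 1) :=
      isCompact_univ_pi fun _ => isCompact_Icc
    have h2 := h1.image (PiLp.continuous_toLp 2 (fun _ : Fin d => ℝ))
    have h3 : {x : Pt d | ∀ i, x i ∈ Icc (0 : ℝ) 1}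
        = WithLp.toLp 2 '' Set.univ.pi fun _ : Fin d => Icc (0 : ℝ) 1 := by
      ext x
      refine ⟨fun hx => ⟨x.ofLp, fun i _ => hx i, rfl⟩, ?_⟩
      rintro ⟨y, hy, rfl⟩ i
      exact hy i (mem_univ i)
    rw [h3]
    exact h2

theorem IsElement.convex {K : Set (Pt d)} (h : IsElement K) : Convex ℝ K := by
  rcases h with ⟨p, -, rfl⟩ | ⟨-, p, -, rfl⟩ | ⟨-, A, rfl⟩
  · exact convex_convexHull ℝ _
  · exact convex_convexHull ℝ _
  · refine Convex.affine_image A.toAffineMap ?_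
    intro x hx y hy a b ha hb hab i
    exact convex_Icc (0 : ℝ) 1 (hx i) (hy i) ha hb hab

/-- Among three distinct collinear points one lies between the other two, so four points in convex
position in the plane are not collinear. -/
theorem affineSpan_eq_top_of_convexIndependent {p : Fin 4 → Pt 2} (hp : ConvexIndependent ℝ p) :
    affineSpan ℝ (range p) = ⊤ := by
  by_contra hne
  have hcol : Collinear ℝ (range p) := by
    rw [collinear_iff_finrank_le_one]
    have h0 : (affineSpan ℝ (range p)).direction ≠ ⊤ := fun h =>
      hne ((AffineSubspace.direction_eq_top_iff_of_nonempty
        ((affineSpan_nonempty ℝ).2 (range_nonempty p))).1 h)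
    rw [direction_affineSpan] at h0
    have h1 := Submodule.finrank_lt h0
    have h2 : Module.finrank ℝ (Pt 2) = 2 := by simp
    omega
  have hsub : Collinear ℝ ({p 0, p 1, p 2} : Set (Pt 2)) := by
    refine hcol.subset ?_
    rintro x (rfl | rfl | rfl) <;> exact mem_range_self _
  have key : ∀ i j l : Fin 4, j ≠ i → j ≠ l → ¬ Wbtw ℝ (p i) (p j) (p l) := by
    intro i j l hji hjl hw
    have h1 : p j ∈ convexHull ℝ (p '' {i, l}) := by
      rw [image_pair, convexHull_pair]
      exact mem_segment_iff_wbtw.2 hw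
    rcases hp _ _ h1 with h | h
    · exact hji h
    · exact hjl h
  rcases hsub.wbtw_or_wbtw_or_wbtw with h | h | h
  · exact key 0 1 2 (by decide) (by decide) h
  · exact key 1 2 0 (by decide) (by decide) h
  · exact key 2 0 1 (by decide) (by decide) h

theorem IsElement.interior_nonempty {K : Set (Pt d)} (h : IsElement K) :
    (interior K).Nonempty := by
  rcases h with ⟨p, hp, rfl⟩ | ⟨hd, p, hp, rfl⟩ | ⟨-, A, rfl⟩
  · rw [interior_convexHull_nonempty_iff_affineSpan_eq_top,
      hp.affineSpan_eq_top_iff_card_eq_finrank_add_one]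
    simp
  · subst hd
    rw [interior_convexHull_nonempty_iff_affineSpan_eq_top]
    exact affineSpan_eq_top_of_convexIndependent hp
  · let e := (AffineEquiv.toContinuousAffineEquiv A).toHomeomorph
    change (interior (e '' _)).Nonempty
    rw [← e.image_interior]
    refine Set.Nonempty.image _ ⟨WithLp.toLp 2 fun _ => 1 / 2, ?_⟩
    rw [mem_interior]
    refine ⟨{x : Pt d | ∀ i, x i ∈ Ioo (0 : ℝ) 1}, fun x hx i => Ioo_subset_Icc_self (hx i), ?_, ?_⟩
    · simp only [ofPred_forall]
      exact isOpen_iInter_of_finite fun i =>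
        isOpen_Ioo.preimage (EuclideanSpace.proj (𝕜 := ℝ) i).continuous
    · intro i
      norm_num

namespace Mesh

variable (M : Mesh Ω)

theorem isCompact_elem (K : M.elems) : IsCompact K.1 := (M.isElement K.1 K.2).isCompact

theorem elem_subset_closure (K : M.elems) : K.1 ⊆ closure Ω := by
  rw [← M.cover]
  exact subset_biUnion_of_mem (u := fun K => K) K.2

/-- The part of an element lying in `Ω` is large enough to determine polynomials, even when `Ω` is
not regular. -/
theorem interior_elem_inter_nonempty (K : M.elems) : (interior K.1 ∩ Ω).Nonempty := by
  obtain ⟨x, hx⟩ := (M.isElement K.1 K.2).interior_nonempty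
  exact mem_closure_iff.1 (M.elem_subset_closure K (interior_subset hx)) _ isOpen_interior hx

theorem measurableSet_elem_inter (hΩ : IsOpen Ω) (K : M.elems) : MeasurableSet (K.1 ∩ Ω) :=
  (M.isCompact_elem K).measurableSet.inter hΩ.measurableSet

theorem exists_elem_of_face (F : M.faces) : ∃ K : M.elems, F.1 ⊆ K.1 := by
  rcases (M.mem_faces F.1).1 F.2 with ⟨-, K, hK, K', -, -, hF⟩ | ⟨⟨K, hK, -, n, -, hF⟩, -⟩
  · exact ⟨⟨K, hK⟩, hF ▸ inter_subset_left⟩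
  · exact ⟨⟨K, hK⟩, hF ▸ sep_subset _ _⟩

theorem surf_face_pos (F : M.faces) : 0 < surf d F.1 := by
  rcases (M.mem_faces F.1).1 F.2 with h | ⟨⟨K, hK, h, -⟩, -⟩
  · exact h.1
  · exact h

theorem isCompact_face (F : M.faces) : IsCompact F.1 := by
  rcases (M.mem_faces F.1).1 F.2 with ⟨-, K, hK, K', hK', -, hF⟩ | ⟨⟨K, hK, -, n, -, hF⟩, -⟩
  · rw [hF]
    exact (M.isElement K hK).isCompact.inter (M.isElement K' hK').isCompact
  · have h : F.1 = K ∩ ⋂ y ∈ K, {x | ⟪n, y⟫ ≤ ⟪n, x⟫} := by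
      rw [hF]; ext x; simp
    rw [h]
    refine (M.isElement K hK).isCompact.inter_right (isClosed_biInter fun y _ => ?_)
    exact isClosed_le continuous_const (by fun_prop)

theorem convex_face (F : M.faces) : Convex ℝ F.1 := by
  rcases (M.mem_faces F.1).1 F.2 with ⟨-, K, hK, K', hK', -, hF⟩ | ⟨⟨K, hK, -, n, -, hF⟩, -⟩
  · rw [hF]
    exact (M.isElement K hK).convex.inter (M.isElement K' hK').convex
  · have h : F.1 = K ∩ ⋂ y ∈ K, {x | ⟪n, y⟫ ≤ ⟪n, x⟫} := by
      rw [hF]; ext x; simp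
    rw [h]
    refine (M.isElement K hK).convex.inter (convex_iInter₂ fun y _ => ?_)
    exact convex_halfSpace_ge (innerₛₗ ℝ n).isLinear _

end Mesh

/-- The normalisation of the surface measure plays no role: it is a nonzero multiple of the
Hausdorff measure. -/
theorem surf_eq_smul (d : ℕ) : ∃ c : NNReal, c ≠ 0 ∧
    surf d = c • (Measure.hausdorffMeasure ((d - 1 : ℕ) : ℝ) : Measure (Pt d)) :=
  ⟨_, Measure.addHaarScalarFactor_volume_hausdorffMeasure_ne_zero (d - 1), rfl⟩

/-- An affine map injective on the affine span of `F` is antilipschitz there, so it shrinks the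
surface measure on `F` by at most a constant factor. -/
theorem exists_surf_le_volume_image {F : Set (Pt d)} (c : Pt d →ᵃ[ℝ] (Fin (d - 1) → ℝ))
    (hc : InjOn c (affineSpan ℝ F)) :
    ∃ C : NNReal, ∀ s ⊆ F, surf d s ≤ C * volume (c '' s) := by
  obtain ⟨a, ha, hs⟩ := surf_eq_smul d
  rcases F.eq_empty_or_nonempty with rfl | hF
  · exact ⟨0, fun s hs => by simp [subset_empty_iff.1 hs]⟩
  let S := affineSpan ℝ F
  have : Nonempty S := ((affineSpan_nonempty ℝ).2 hF).to_subtype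
  have hinj : Function.Injective (c.comp S.subtype) := fun x y hxy =>
    Subtype.ext (hc x.2 y.2 hxy)
  obtain ⟨L, hL⟩ := AffineMap.antilipschitzWith_of_finiteDimensional hinj
  refine ⟨a * L ^ (d - 1), fun s hsF => ?_⟩
  have h1 := hL.le_hausdorffMeasure_image (d := ((d - 1 : ℕ) : ℝ)) (by positivity)
    (((↑) : S → Pt d) ⁻¹' s)
  have h2 : ((↑) : S → Pt d) '' (((↑) : S → Pt d) ⁻¹' s) = s := by
    ext x
    refine ⟨?_, fun hx => ⟨⟨x, subset_affineSpan ℝ F (hsF hx)⟩, hx, rfl⟩⟩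
    rintro ⟨y, hy, rfl⟩
    exact hy
  have hiso : Isometry ((↑) : S → Pt d) := fun _ _ => rfl
  have h3 : (c.comp S.subtype) '' (((↑) : S → Pt d) ⁻¹' s) = c '' s := by
    conv_rhs => rw [← h2, image_image]
    rfl
  rw [h3, ← hiso.hausdorffMeasure_image
    (Or.inl (by positivity)), h2] at h1
  have h4 : (Measure.hausdorffMeasure ((d - 1 : ℕ) : ℝ) : Measure (Fin (d - 1) → ℝ)) = volume := by
    have := hausdorffMeasure_pi_real (ι := Fin (d - 1))
    rwa [Fintype.card_fin] at this
  rw [h4] at h1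
  rw [hs, Measure.smul_apply, ENNReal.smul_def, smul_eq_mul]
  refine (mul_le_mul_right h1 _).trans (le_of_eq ?_)
  rw [← mul_assoc, ENNReal.rpow_natCast]
  push_cast
  rfl

/-- Affine maps are Lipschitz, so they send surface null sets to null sets. -/
theorem volume_image_eq_zero {s : Set (Pt d)} (c : Pt d →ᵃ[ℝ] (Fin (d - 1) → ℝ))
    (hs : surf d s = 0) : volume (c '' s) = 0 := by
  obtain ⟨a, ha, hsurf⟩ := surf_eq_smul d
  have h0 : (Measure.hausdorffMeasure ((d - 1 : ℕ) : ℝ) : Measure (Pt d)) s = 0 := by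
    rw [hsurf, Measure.smul_apply, ENNReal.smul_def, smul_eq_mul, mul_eq_zero] at hs
    exact hs.resolve_left (by simpa using ha)
  let c' : Pt d →ᴬ[ℝ] (Fin (d - 1) → ℝ) := ⟨c, c.continuous_of_finiteDimensional⟩
  have hL : LipschitzWith ‖c'.contLinear‖₊ c := by
    refine LipschitzWith.of_dist_le_mul fun x y => ?_
    rw [dist_eq_norm_vsub (Fin (d - 1) → ℝ), dist_eq_norm_vsub (Pt d), ← c.linearMap_vsub]
    exact c'.contLinear.le_opNorm _
  have h1 := hL.hausdorffMeasure_image_le (d := ((d - 1 : ℕ) : ℝ)) (by positivity) s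
  have h4 : (Measure.hausdorffMeasure ((d - 1 : ℕ) : ℝ) : Measure (Fin (d - 1) → ℝ)) = volume := by
    have := hausdorffMeasure_pi_real (ι := Fin (d - 1))
    rwa [Fintype.card_fin] at this
  rw [h0, mul_zero, h4] at h1
  exact le_antisymm h1 zero_le

namespace Mesh

variable (M : Mesh Ω)

theorem surf_face_lt_top (F : M.faces) : surf d F.1 < ⊤ := by
  obtain ⟨C, hC⟩ := exists_surf_le_volume_image _ (M.faceCoord_injOn F.1 F.2)
  refine (hC _ subset_rfl).trans_lt (ENNReal.mul_lt_top ENNReal.coe_lt_top ?_)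
  exact ((M.isCompact_face F).image
    (M.faceCoord F.1).continuous_of_finiteDimensional).measure_lt_top

theorem diam_face_pos (hd : 2 ≤ d) (F : M.faces) : 0 < Metric.diam F.1 := by
  refine lt_of_le_of_ne Metric.diam_nonneg fun h0 => (M.surf_face_pos F).ne' ?_
  -- a face of zero diameter is a point, which is null because `d - 1 > 0`
  have hsub : F.1.Subsingleton := fun x hx y hy => by
    have := Metric.dist_le_diam_of_mem (M.isCompact_face F).isBounded hx hy
    rw [← h0] at this
    exact dist_le_zero.1 this
  obtain ⟨a, -, hs⟩ := surf_eq_smul d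
  have : NullSingletonClass (Measure.hausdorffMeasure ((d - 1 : ℕ) : ℝ) : Measure (Pt d)) :=
    Measure.nullSingletonClass_hausdorff _ (by exact_mod_cast (by omega : 0 < d - 1))
  rw [hs, Measure.smul_apply, hsub.measure_zero _, smul_zero]

/-- A function continuous in the face coordinates that vanishes almost everywhere on a face vanishes
on the whole face: the image of the face is a convex body, the closure of its interior. -/
theorem eqOn_zero_face_of_ae (F : M.faces) {q : (Fin (d - 1) → ℝ) → ℝ} (hq : Continuous q)
    (h : ∀ᵐ x ∂(surf d).restrict F.1, q (M.faceCoord F.1 x) = 0) :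
    ∀ x ∈ F.1, q (M.faceCoord F.1 x) = 0 := by
  set c := M.faceCoord F.1 with hc
  have hcont : Continuous c := c.continuous_of_finiteDimensional
  have hconv : Convex ℝ (c '' F.1) := (M.convex_face F).affine_image c
  have hcomp : IsCompact (c '' F.1) := (M.isCompact_face F).image hcont
  rw [ae_restrict_iff' (M.isCompact_face F).measurableSet, ae_iff] at h
  have h1 := volume_image_eq_zero c h
  obtain ⟨C, hC⟩ := exists_surf_le_volume_image _ (M.faceCoord_injOn F.1 F.2)
  have hpos : volume (c '' F.1) ≠ 0 := fun h0 => by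
    have := hC _ subset_rfl
    rw [← hc, h0, mul_zero] at this
    exact (M.surf_face_pos F).ne' (le_antisymm this zero_le)
  have hint : (interior (c '' F.1)).Nonempty := by
    by_contra hne
    rw [not_nonempty_iff_eq_empty] at hne
    refine hpos (measure_mono_null ?_ (hconv.addHaar_frontier volume))
    rw [frontier, hne, sdiff_empty]
    exact subset_closure
  have hclos : c '' F.1 ⊆ closure (interior (c '' F.1)) := by
    rw [hconv.closure_interior_eq_closure_of_nonempty_interior hint]
    exact subset_closure
  have hopen : IsOpen (interior (c '' F.1) ∩ {y | q y ≠ 0}) :=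
    isOpen_interior.inter (isOpen_ne_fun hq continuous_const)
  have hempty : interior (c '' F.1) ∩ {y | q y ≠ 0} = ∅ := by
    rw [← hopen.measure_eq_zero_iff volume]
    refine measure_mono_null ?_ h1
    rintro y ⟨hy, hqy⟩
    obtain ⟨x, hx, rfl⟩ := interior_subset hy
    exact ⟨x, fun hcon => hqy (hcon hx), rfl⟩
  have hzero : EqOn q 0 (interior (c '' F.1)) := fun y hy => by
    by_contra hne
    exact (eq_empty_iff_forall_notMem.1 hempty y) ⟨hy, hne⟩
  intro x hx
  exact hzero.closure hq continuous_zero (hclos (mem_image_of_mem c hx))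

end Mesh

end Geometry

/-! ### Piecewise polynomials -/

section Polynomials

variable {d : ℕ} {Ω : Set (Pt d)}

theorem finite_restrictSupport {n ℓ : ℕ} {s : Set (Fin n →₀ ℕ)} (hs : ∀ m ∈ s, ∀ i, m i ≤ ℓ) :
    Module.Finite ℝ (MvPolynomial.restrictSupport ℝ s) := by
  have hfin : s.Finite := by
    refine (Set.finite_Icc (0 : Fin n →₀ ℕ) (Finsupp.equivFunOnFinite.symm fun _ => ℓ)).subset ?_
    exact fun m hm => ⟨zero_le, fun i => hs m hm i⟩
  have : Finite s := hfin
  exact Module.Finite.of_basis (MvPolynomial.basisRestrictSupport ℝ s)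

instance finite_restrictTotalDegree (n ℓ : ℕ) :
    Module.Finite ℝ (MvPolynomial.restrictTotalDegree (Fin n) ℝ ℓ) :=
  finite_restrictSupport (ℓ := ℓ) fun m hm i => by
    have hm' : (m.sum fun _ e => e) ≤ ℓ := hm
    by_cases hi : m i = 0
    · omega
    · exact (Finset.single_le_sum (f := fun j => m j) (fun _ _ => Nat.zero_le _)
        (Finsupp.mem_support_iff.2 hi)).trans hm'

instance finite_restrictDegree (n ℓ : ℕ) :
    Module.Finite ℝ (MvPolynomial.restrictDegree (Fin n) ℝ ℓ) :=
  finite_restrictSupport (ℓ := ℓ) fun _ hm => hm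

theorem contDiff_aeval {n : ℕ} {c : Pt d → Fin n → ℝ} (hc : ContDiff ℝ 1 c)
    (q : MvPolynomial (Fin n) ℝ) : ContDiff ℝ 1 fun x => MvPolynomial.aeval (c x) q := by
  induction q using MvPolynomial.induction_on with
  | C a => simpa using contDiff_const
  | add p q hp hq => simpa using hp.add hq
  | mul_X p i hp => simpa using hp.mul (contDiff_pi.1 hc i)

namespace Mesh

variable (M : Mesh Ω)

instance finite_poly (ℓ : ℕ) (K : Set (Pt d)) : Module.Finite ℝ (M.poly ℓ K) := by
  by_cases h : IsSimplex d K
  · rw [show M.poly ℓ K = _ from if_pos h]; infer_instance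
  · rw [show M.poly ℓ K = _ from if_neg h]; infer_instance

instance finite_facePoly (ℓ : ℕ) (F : Set (Pt d)) : Module.Finite ℝ (M.facePoly ℓ F) := by
  by_cases h : IsSimplex (d - 1) F
  · rw [show M.facePoly ℓ F = _ from if_pos h]; infer_instance
  · rw [show M.facePoly ℓ F = _ from if_neg h]; infer_instance

variable {M}

theorem exists_of_mem_poly {ℓ : ℕ} {K : Set (Pt d)} {f : Pt d → ℝ} (hf : f ∈ M.poly ℓ K) :
    ∃ q : MvPolynomial (Fin d) ℝ, f = fun x => MvPolynomial.aeval (M.elemCoord K x) q := by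
  rw [poly] at hf
  split_ifs at hf <;>
  · obtain ⟨q, -, rfl⟩ := hf
    exact ⟨q, rfl⟩

theorem exists_of_mem_facePoly {ℓ : ℕ} {F : Set (Pt d)} {f : Pt d → ℝ} (hf : f ∈ M.facePoly ℓ F) :
    ∃ q : MvPolynomial (Fin (d - 1)) ℝ,
      f = F.indicator fun x => MvPolynomial.aeval (M.faceCoord F x) q := by
  rw [facePoly] at hf
  split_ifs at hf <;>
  · obtain ⟨q, -, rfl⟩ := hf
    exact ⟨q, rfl⟩

theorem contDiff_of_mem_poly {ℓ : ℕ} {K : Set (Pt d)} {f : Pt d → ℝ} (hf : f ∈ M.poly ℓ K) :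
    ContDiff ℝ 1 f := by
  obtain ⟨q, rfl⟩ := exists_of_mem_poly hf
  let c : Pt d →ᴬ[ℝ] (Fin d → ℝ) :=
    ⟨(M.elemCoord K).toAffineMap, (M.elemCoord K).toAffineMap.continuous_of_finiteDimensional⟩
  exact contDiff_aeval c.contDiff q

theorem continuous_of_mem_poly {ℓ : ℕ} {K : Set (Pt d)} {f : Pt d → ℝ} (hf : f ∈ M.poly ℓ K) :
    Continuous f := (contDiff_of_mem_poly hf).continuous

/-- A polynomial vanishing on a nonempty open set vanishes identically. -/
theorem eq_zero_of_mem_poly {ℓ : ℕ} {K : Set (Pt d)} {f : Pt d → ℝ} (hf : f ∈ M.poly ℓ K)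
    {U : Set (Pt d)} (hU : IsOpen U) (hne : U.Nonempty) (h0 : ∀ x ∈ U, f x = 0) : f = 0 := by
  obtain ⟨q, rfl⟩ := exists_of_mem_poly hf
  let e := (AffineEquiv.toContinuousAffineEquiv (M.elemCoord K)).toHomeomorph
  obtain ⟨x, hx⟩ := hne
  have hopen : IsOpen (e '' U) := e.isOpenMap U hU
  obtain ⟨ε, hε, hball⟩ := Metric.isOpen_iff.1 hopen (e x) (mem_image_of_mem e hx)
  have hq : q = 0 := by
    refine MvPolynomial.funext_set (fun i => Metric.ball (e x i) ε) (fun i => ?_) fun y hy => ?_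
    · rw [Real.ball_eq_Ioo]
      exact Ioo_infinite (by linarith)
    · have hy' : y ∈ Metric.ball (e x) ε := by
        rw [ball_pi _ hε]; exact hy
      obtain ⟨z, hz, rfl⟩ := hball hy'
      have h1 := h0 z hz
      simp only [MvPolynomial.aeval_eq_eval] at h1
      rw [map_zero]
      exact h1
  subst hq
  ext y
  simp

theorem continuousOn_of_mem_facePoly {ℓ : ℕ} {F : Set (Pt d)} {f : Pt d → ℝ}
    (hf : f ∈ M.facePoly ℓ F) : ContinuousOn f F := by
  obtain ⟨q, rfl⟩ := exists_of_mem_facePoly hf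
  have h : Continuous fun x => MvPolynomial.aeval (M.faceCoord F x) q :=
    (MvPolynomial.continuous_eval q |>.comp
      (M.faceCoord F).continuous_of_finiteDimensional).congr fun x => by
        simp [MvPolynomial.aeval_eq_eval]
  exact h.continuousOn.congr fun x hx => indicator_of_mem hx _

theorem eq_zero_of_mem_facePoly_of_ae {ℓ : ℕ} {F : M.faces} {f : Pt d → ℝ}
    (hf : f ∈ M.facePoly ℓ F) (h0 : ∀ᵐ x ∂(surf d).restrict F.1, f x = 0) : f = 0 := by
  obtain ⟨q, rfl⟩ := exists_of_mem_facePoly hf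
  have hcont : Continuous fun y : Fin (d - 1) → ℝ => MvPolynomial.aeval y q :=
    (MvPolynomial.continuous_eval q).congr fun x => by
        simp [MvPolynomial.aeval_eq_eval]
  have h1 := M.eqOn_zero_face_of_ae F hcont (by
    filter_upwards [h0, ae_restrict_mem (M.isCompact_face F).measurableSet] with x hx hxF
    rwa [indicator_of_mem hxF] at hx)
  ext x
  by_cases hx : x ∈ F.1
  · rw [indicator_of_mem hx]; exact h1 x hx
  · rw [indicator_of_notMem hx]; rfl

/-! ### Integration over elements and faces -/

theorem integrable_elem (K : M.elems) {f : Pt d → ℝ} (hf : Continuous f) :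
    IntegrableOn f (K.1 ∩ Ω) :=
  (hf.continuousOn.integrableOn_compact (M.isCompact_elem K)).mono_set inter_subset_left

theorem integrable_face (F : M.faces) {f : Pt d → ℝ} (hf : ContinuousOn f F.1) :
    IntegrableOn f F.1 (surf d) := by
  have : IsFiniteMeasure ((surf d).restrict F.1) :=
    ⟨by rw [Measure.restrict_apply_univ]; exact M.surf_face_lt_top F⟩
  obtain ⟨C, hC⟩ := (M.isCompact_face F).exists_bound_of_continuousOn hf
  exact Integrable.of_bound (hf.aestronglyMeasurable_of_isCompact (M.isCompact_face F)
    (M.isCompact_face F).measurableSet) C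
    (by filter_upwards [ae_restrict_mem (M.isCompact_face F).measurableSet] with x hx
          using hC x hx)

/-- A nonnegative continuous function with vanishing integral over `K ∩ Ω` is zero on the open set
`interior K ∩ Ω`. -/
theorem eq_zero_of_integral_elem (hΩ : IsOpen Ω) (K : M.elems) {f : Pt d → ℝ} (hf : Continuous f)
    (h0 : ∀ x, 0 ≤ f x) (h : ∫ x in K.1 ∩ Ω, f x = 0) :
    ∀ x ∈ interior K.1 ∩ Ω, f x = 0 := by
  have h1 := (integral_eq_zero_iff_of_nonneg h0 (integrable_elem K hf)).1 h
  have hsub : interior K.1 ∩ Ω ⊆ K.1 ∩ Ω := inter_subset_inter_left _ interior_subset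
  exact Measure.eqOn_open_of_ae_eq (ae_restrict_of_ae_restrict_of_subset hsub h1)
    (isOpen_interior.inter hΩ) hf.continuousOn continuousOn_const

end Mesh

end Polynomials

/-! ### Elementwise `L²` projections -/

/-- A bilinear form on a finite-dimensional space without isotropic vectors represents every linear
functional exactly once. -/
theorem existsUnique_of_definite {V : Type*} [AddCommGroup V] [Module ℝ V] [Module.Finite ℝ V]
    (B : V →ₗ[ℝ] V →ₗ[ℝ] ℝ) (hB : ∀ x, B x x = 0 → x = 0) (φ : V →ₗ[ℝ] ℝ) :
    ∃! x, ∀ y, B x y = φ y := by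
  have hinj : Function.Injective B := (injective_iff_map_eq_zero B).2 fun x hx =>
    hB x (by rw [hx]; rfl)
  have hsurj : Function.Surjective B :=
    (LinearMap.injective_iff_surjective_of_finrank_eq_finrank
      (f := B) Subspace.dual_finrank_eq.symm).1 hinj
  obtain ⟨x, hx⟩ := hsurj φ
  exact ⟨x, fun y => by rw [hx], fun z hz => hinj (by rw [hx]; exact LinearMap.ext hz)⟩

section Projection

variable {d : ℕ} {Ω : Set (Pt d)} {M : Mesh Ω}

/-- Testing against a continuous function on an element is a bounded functional on `L²(Ω)`. -/
theorem exists_pairing {E : Type*} [NormedAddCommGroup E] [InnerProductSpace ℝ E]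
    (hΩ : IsOpen Ω) (K : M.elems) {y : Pt d → E} (hy : Continuous y) :
    ∃ L : Lp E 2 (volume.restrict Ω) →L[ℝ] ℝ, ∀ f : Lp E 2 (volume.restrict Ω),
      IntegrableOn (fun x => ⟪f x, y x⟫) (K.1 ∩ Ω) ∧ L f = ∫ x in K.1 ∩ Ω, ⟪f x, y x⟫ := by
  have hK : MeasurableSet K.1 := (M.isCompact_elem K).measurableSet
  have hmem : MemLp (K.1.indicator y) 2 (volume.restrict Ω) := by
    rw [memLp_indicator_iff_restrict hK, Measure.restrict_restrict hK]
    have hfin : IsFiniteMeasure (volume.restrict (K.1 ∩ Ω)) :=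
      ⟨by rw [Measure.restrict_apply_univ]
          exact (measure_mono inter_subset_left).trans_lt (M.isCompact_elem K).measure_lt_top⟩
    obtain ⟨C, hC⟩ := (M.isCompact_elem K).exists_bound_of_continuousOn hy.continuousOn
    have hmeas : AEStronglyMeasurable y (volume.restrict (K.1 ∩ Ω)) :=
      (hy.continuousOn.aestronglyMeasurable_of_isCompact (M.isCompact_elem K) hK).mono_measure
        (Measure.restrict_mono_set _ inter_subset_left)
    exact MemLp.of_bound hmeas C
      (by filter_upwards [ae_restrict_mem (M.measurableSet_elem_inter hΩ K)] with x hx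
            using hC x hx.1)
  have hae : ∀ f : Lp E 2 (volume.restrict Ω),
      (fun x => ⟪hmem.toLp (K.1.indicator y) x, f x⟫) =ᵐ[volume.restrict Ω]
        K.1.indicator fun x => ⟪f x, y x⟫ := fun f => by
    filter_upwards [hmem.coeFn_toLp] with x hx
    rw [hx]
    by_cases hxK : x ∈ K.1
    · simp [hxK, real_inner_comm]
    · simp [hxK]
  refine ⟨innerSL ℝ (hmem.toLp (K.1.indicator y)), fun f => ⟨?_, ?_⟩⟩
  · have h1 := (L2.integrable_inner (𝕜 := ℝ) (hmem.toLp (K.1.indicator y)) f).congr (hae f)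
    rwa [integrable_indicator_iff hK, IntegrableOn, Measure.restrict_restrict hK] at h1
  · rw [innerSL_apply_apply, L2.inner_def, integral_congr_ae (hae f), integral_indicator hK,
      Measure.restrict_restrict hK]

theorem exists_pairing_real (hΩ : IsOpen Ω) (K : M.elems) {q : Pt d → ℝ} (hq : Continuous q) :
    ∃ L : Lp ℝ 2 (volume.restrict Ω) →L[ℝ] ℝ, ∀ f : Lp ℝ 2 (volume.restrict Ω),
      IntegrableOn (fun x => f x * q x) (K.1 ∩ Ω) ∧ L f = ∫ x in K.1 ∩ Ω, f x * q x := by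
  obtain ⟨L, hL⟩ := exists_pairing (E := ℝ) hΩ K hq
  refine ⟨L, fun f => ?_⟩
  have := hL f
  simpa only [RCLike.inner_apply, conj_trivial, mul_comm] using this

theorem exists_pairing_coord (hΩ : IsOpen Ω) (K : M.elems) (i : Fin d) {q : Pt d → ℝ}
    (hq : Continuous q) :
    ∃ L : Lp (Pt d) 2 (volume.restrict Ω) →L[ℝ] ℝ, ∀ f : Lp (Pt d) 2 (volume.restrict Ω),
      IntegrableOn (fun x => f x i * q x) (K.1 ∩ Ω) ∧ L f = ∫ x in K.1 ∩ Ω, f x i * q x := by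
  obtain ⟨L, hL⟩ := exists_pairing (E := Pt d) hΩ K
    (y := fun x => q x • EuclideanSpace.single i (1 : ℝ)) (by fun_prop)
  refine ⟨L, fun f => ?_⟩
  have := hL f
  simpa only [inner_smul_right, EuclideanSpace.inner_single_right, one_mul, conj_trivial,
    mul_comm] using this

/-- The `L²(K ∩ Ω)` inner product on the polynomials of an element. -/
noncomputable def polyInner (M : Mesh Ω) (K : M.elems) (ℓ : ℕ) :
    M.poly ℓ K →ₗ[ℝ] M.poly ℓ K →ₗ[ℝ] ℝ :=
  have hint : ∀ f g : M.poly ℓ K, IntegrableOn (fun x => f.1 x * g.1 x) (K.1 ∩ Ω) := fun f g =>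
    Mesh.integrable_elem K
      ((Mesh.continuous_of_mem_poly f.2).mul (Mesh.continuous_of_mem_poly g.2))
  LinearMap.mk₂ ℝ (fun f g => ∫ x in K.1 ∩ Ω, f.1 x * g.1 x)
    (fun f f' g => by
      rw [← integral_add (hint f g) (hint f' g)]
      simp only [Submodule.coe_add, Pi.add_apply, add_mul])
    (fun c f g => by
      rw [smul_eq_mul, ← integral_const_mul]
      simp only [Submodule.coe_smul, Pi.smul_apply, smul_eq_mul, mul_assoc])
    (fun f g g' => by
      rw [← integral_add (hint f g) (hint f g')]
      simp only [Submodule.coe_add, Pi.add_apply, mul_add])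
    (fun c f g => by
      rw [smul_eq_mul, ← integral_const_mul]
      simp only [Submodule.coe_smul, Pi.smul_apply, smul_eq_mul, mul_left_comm])

theorem polyInner_apply (K : M.elems) (ℓ : ℕ) (f g : M.poly ℓ K) :
    polyInner M K ℓ f g = ∫ x in K.1 ∩ Ω, f.1 x * g.1 x := rfl

theorem polyInner_definite (hΩ : IsOpen Ω) (K : M.elems) (ℓ : ℕ) (f : M.poly ℓ K)
    (hf : polyInner M K ℓ f f = 0) : f = 0 := by
  have hc := Mesh.continuous_of_mem_poly f.2
  have h1 := Mesh.eq_zero_of_integral_elem hΩ K (hc.mul hc) (fun x => mul_self_nonneg _) hf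
  exact Subtype.ext (Mesh.eq_zero_of_mem_poly f.2 (isOpen_interior.inter hΩ)
    (M.interior_elem_inter_nonempty K) fun x hx => mul_self_eq_zero.1 (h1 x hx))

/-- `f` has finite moments against polynomials of degree `ℓ` on `K`. -/
def HasMoments (M : Mesh Ω) (K : M.elems) (ℓ : ℕ) (f : Pt d → ℝ) : Prop :=
  ∀ q ∈ M.poly ℓ K, IntegrableOn (fun x => f x * q x) (K.1 ∩ Ω)

theorem isL2Proj_iff (K : M.elems) (ℓ : ℕ) {f : Pt d → ℝ} (hf : HasMoments M K ℓ f)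
    (g : M.poly ℓ K) :
    IsL2Proj (volume.restrict (K.1 ∩ Ω)) (M.poly ℓ K) f g.1 ↔
      ∀ q : M.poly ℓ K, polyInner M K ℓ g q = ∫ x in K.1 ∩ Ω, f x * q.1 x := by
  have key : ∀ q : M.poly ℓ K, ∫ x in K.1 ∩ Ω, (f x - g.1 x) * q.1 x
      = (∫ x in K.1 ∩ Ω, f x * q.1 x) - polyInner M K ℓ g q := fun q => by
    have hgq : IntegrableOn (fun x => g.1 x * q.1 x) (K.1 ∩ Ω) := Mesh.integrable_elem K
      ((Mesh.continuous_of_mem_poly g.2).mul (Mesh.continuous_of_mem_poly q.2))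
    rw [polyInner_apply, ← integral_sub (hf q.1 q.2) hgq]
    simp only [sub_mul]
  constructor
  · rintro ⟨-, h⟩ q
    have := h q.1 q.2
    rw [key, sub_eq_zero] at this
    exact this.symm
  · intro h
    exact ⟨g.2, fun q hq => by rw [key ⟨q, hq⟩, h, sub_self]⟩

theorem existsUnique_isL2Proj (hΩ : IsOpen Ω) (K : M.elems) (ℓ : ℕ) {f : Pt d → ℝ}
    (hf : HasMoments M K ℓ f) :
    ∃! g, IsL2Proj (volume.restrict (K.1 ∩ Ω)) (M.poly ℓ K) f g := by
  let φ : M.poly ℓ K →ₗ[ℝ] ℝ :=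
    { toFun := fun q => ∫ x in K.1 ∩ Ω, f x * q.1 x
      map_add' := fun q r => by
        rw [← integral_add (hf q.1 q.2) (hf r.1 r.2)]
        simp only [Submodule.coe_add, Pi.add_apply, mul_add]
      map_smul' := fun c q => by
        rw [RingHom.id_apply, smul_eq_mul, ← integral_const_mul]
        simp only [Submodule.coe_smul, Pi.smul_apply, smul_eq_mul, mul_left_comm] }
  obtain ⟨g, hg, huniq⟩ := existsUnique_of_definite _ (polyInner_definite hΩ K ℓ) φ
  refine ⟨g.1, (isL2Proj_iff K ℓ hf g).2 hg, fun g' hg' => ?_⟩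
  exact congrArg Subtype.val (huniq ⟨g', hg'.1⟩ ((isL2Proj_iff K ℓ hf ⟨g', hg'.1⟩).1 hg'))

/-- Point values of an `L²` projection are moments of the projected function: point evaluation is
represented in the `L²` inner product of the finite-dimensional polynomial space. -/
theorem exists_representer (hΩ : IsOpen Ω) (K : M.elems) (ℓ : ℕ) (x : Pt d) :
    ∃ q ∈ M.poly ℓ K, ∀ f g : Pt d → ℝ, HasMoments M K ℓ f →
      IsL2Proj (volume.restrict (K.1 ∩ Ω)) (M.poly ℓ K) f g →
        g x = ∫ y in K.1 ∩ Ω, f y * q y := by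
  obtain ⟨q, hq, -⟩ := existsUnique_of_definite _ (polyInner_definite hΩ K ℓ)
    ((LinearMap.proj x : (Pt d → ℝ) →ₗ[ℝ] ℝ) ∘ₗ (M.poly ℓ K).subtype)
  refine ⟨q.1, q.2, fun f g hf hg => ?_⟩
  rw [← (isL2Proj_iff K ℓ hf ⟨g, hg.1⟩).1 hg q, polyInner_apply]
  have h1 := hq ⟨g, hg.1⟩
  rw [polyInner_apply] at h1
  simp only [mul_comm (g _)]
  exact h1.symm

theorem hasMoments_real (hΩ : IsOpen Ω) (K : M.elems) (ℓ : ℕ) (f : Lp ℝ 2 (volume.restrict Ω)) :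
    HasMoments M K ℓ f := fun q hq => by
  obtain ⟨L, hL⟩ := exists_pairing_real hΩ K (Mesh.continuous_of_mem_poly hq)
  exact (hL f).1

theorem hasMoments_coord (hΩ : IsOpen Ω) (K : M.elems) (ℓ : ℕ) (i : Fin d)
    (f : Lp (Pt d) 2 (volume.restrict Ω)) : HasMoments M K ℓ fun x => f x i := fun q hq => by
  obtain ⟨L, hL⟩ := exists_pairing_coord hΩ K i (Mesh.continuous_of_mem_poly hq)
  exact (hL f).1

theorem exists_abs_le_of_isL2Proj_real (hΩ : IsOpen Ω) (K : M.elems) (ℓ : ℕ) (x : Pt d) :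
    ∃ C : ℝ, 0 ≤ C ∧ ∀ (f : Lp ℝ 2 (volume.restrict Ω)) (g : Pt d → ℝ),
      IsL2Proj (volume.restrict (K.1 ∩ Ω)) (M.poly ℓ K) f g → |g x| ≤ C * ‖f‖ := by
  obtain ⟨q, hq, hrep⟩ := exists_representer hΩ K ℓ x
  obtain ⟨L, hL⟩ := exists_pairing_real hΩ K (Mesh.continuous_of_mem_poly hq)
  refine ⟨‖L‖, norm_nonneg _, fun f g hg => ?_⟩
  rw [hrep f g (hasMoments_real hΩ K ℓ f) hg, ← (hL f).2]
  exact L.le_opNorm f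

theorem exists_abs_le_of_isL2Proj_coord (hΩ : IsOpen Ω) (K : M.elems) (ℓ : ℕ) (i : Fin d)
    (x : Pt d) :
    ∃ C : ℝ, 0 ≤ C ∧ ∀ (f : Lp (Pt d) 2 (volume.restrict Ω)) (g : Pt d → ℝ),
      IsL2Proj (volume.restrict (K.1 ∩ Ω)) (M.poly ℓ K) (fun x => f x i) g →
        |g x| ≤ C * ‖f‖ := by
  obtain ⟨q, hq, hrep⟩ := exists_representer hΩ K ℓ x
  obtain ⟨L, hL⟩ := exists_pairing_coord hΩ K i (Mesh.continuous_of_mem_poly hq)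
  refine ⟨‖L‖, norm_nonneg _, fun f g hg => ?_⟩
  rw [hrep _ g (hasMoments_coord hΩ K ℓ i f) hg, ← (hL f).2]
  exact L.le_opNorm f

end Projection

/-! ### The discrete space as a vector space -/

section Space

variable {d : ℕ} {Ω : Set (Pt d)} {M : Mesh Ω}

namespace HDGField

/-- A field is the tuple of its components; the vector space structure is transported along this
bijection. -/
def equivProd (M : Mesh Ω) : HDGField M ≃
    (M.elems → Fin 3 → Pt d → Pt d) × (M.faces → Fin 3 → Pt d → Pt d) ×
      (M.elems → Pt d → Sym d) × (M.elems → Pt d → ℝ) × (M.elems → Pt d → ℝ) where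
  toFun X := (X.vel, X.velHat, X.stress, X.pres, X.temp)
  invFun Y := ⟨Y.1, Y.2.1, Y.2.2.1, Y.2.2.2.1, Y.2.2.2.2⟩
  left_inv _ := rfl
  right_inv _ := rfl

instance : AddCommGroup (HDGField M) := (equivProd M).addCommGroup

instance : Module ℝ (HDGField M) := (equivProd M).module ℝ

@[simp] theorem zero_vel : (0 : HDGField M).vel = 0 := rfl
@[simp] theorem zero_velHat : (0 : HDGField M).velHat = 0 := rfl
@[simp] theorem zero_stress : (0 : HDGField M).stress = 0 := rfl
@[simp] theorem zero_pres : (0 : HDGField M).pres = 0 := rfl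
@[simp] theorem zero_temp : (0 : HDGField M).temp = 0 := rfl
@[simp] theorem add_vel (X Y : HDGField M) : (X + Y).vel = X.vel + Y.vel := rfl
@[simp] theorem add_velHat (X Y : HDGField M) : (X + Y).velHat = X.velHat + Y.velHat := rfl
@[simp] theorem add_stress (X Y : HDGField M) : (X + Y).stress = X.stress + Y.stress := rfl
@[simp] theorem add_pres (X Y : HDGField M) : (X + Y).pres = X.pres + Y.pres := rfl
@[simp] theorem add_temp (X Y : HDGField M) : (X + Y).temp = X.temp + Y.temp := rfl
@[simp] theorem smul_vel (c : ℝ) (X : HDGField M) : (c • X).vel = c • X.vel := rfl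
@[simp] theorem smul_velHat (c : ℝ) (X : HDGField M) : (c • X).velHat = c • X.velHat := rfl
@[simp] theorem smul_stress (c : ℝ) (X : HDGField M) : (c • X).stress = c • X.stress := rfl
@[simp] theorem smul_pres (c : ℝ) (X : HDGField M) : (c • X).pres = c • X.pres := rfl
@[simp] theorem smul_temp (c : ℝ) (X : HDGField M) : (c • X).temp = c • X.temp := rfl

variable (M) in
/-- The discrete space `H_{1,h} × Ĥ_{1,h} × H_{2,h}` as a submodule. -/
def space (k : ℕ) : Submodule ℝ (HDGField M) where
  carrier := {X | X.MemSpace k}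
  add_mem' {X Y} hX hY :=
    { vel := fun K j i => (M.poly (k + 1) K.1).add_mem (hX.vel K j i) (hY.vel K j i)
      velHat := fun F j i => (M.facePoly (k + 1) F.1).add_mem (hX.velHat F j i) (hY.velHat F j i)
      velHat_boundary := fun F hF => by
        rw [add_velHat, Pi.add_apply, Pi.add_apply, hX.velHat_boundary F hF,
          hY.velHat_boundary F hF, add_zero]
      stress := fun K i j => (M.poly k K.1).add_mem (hX.stress K i j) (hY.stress K i j)
      pres := fun K => (M.poly k K.1).add_mem (hX.pres K) (hY.pres K)
      temp := fun K => (M.poly k K.1).add_mem (hX.temp K) (hY.temp K) }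
  zero_mem' :=
    { vel := fun K _ _ => (M.poly (k + 1) K.1).zero_mem
      velHat := fun F _ _ => (M.facePoly (k + 1) F.1).zero_mem
      velHat_boundary := fun _ _ => rfl
      stress := fun K _ _ => (M.poly k K.1).zero_mem
      pres := fun K => (M.poly k K.1).zero_mem
      temp := fun K => (M.poly k K.1).zero_mem }
  smul_mem' c X hX :=
    { vel := fun K j i => (M.poly (k + 1) K.1).smul_mem c (hX.vel K j i)
      velHat := fun F j i => (M.facePoly (k + 1) F.1).smul_mem c (hX.velHat F j i)
      velHat_boundary := fun F hF => by
        rw [smul_velHat, Pi.smul_apply, Pi.smul_apply, hX.velHat_boundary F hF, smul_zero]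
      stress := fun K i j => (M.poly k K.1).smul_mem c (hX.stress K i j)
      pres := fun K => (M.poly k K.1).smul_mem c (hX.pres K)
      temp := fun K => (M.poly k K.1).smul_mem c (hX.temp K) }

variable (M) in
instance finite_space (k : ℕ) : Module.Finite ℝ (space M k) := by
  let f : space M k →ₗ[ℝ]
      ((K : M.elems) → Fin 3 → Fin d → M.poly (k + 1) K.1) ×
      ((F : M.faces) → Fin 3 → Fin d → M.facePoly (k + 1) F.1) ×
      ((K : M.elems) → Fin d → Fin d → M.poly k K.1) ×
      ((K : M.elems) → M.poly k K.1) × ((K : M.elems) → M.poly k K.1) :=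
    { toFun := fun X => (fun K j i => ⟨_, X.2.vel K j i⟩, fun F j i => ⟨_, X.2.velHat F j i⟩,
        fun K i j => ⟨_, X.2.stress K i j⟩, fun K => ⟨_, X.2.pres K⟩, fun K => ⟨_, X.2.temp K⟩)
      map_add' := fun _ _ => rfl
      map_smul' := fun _ _ => rfl }
  refine Module.Finite.of_injective f fun X Y hXY => ?_
  have h1 := congrArg Prod.fst hXY
  have h2 := congrArg (fun p => p.2.1) hXY
  have h3 := congrArg (fun p => p.2.2.1) hXY
  have h4 := congrArg (fun p => p.2.2.2.1) hXY
  have h5 := congrArg (fun p => p.2.2.2.2) hXY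
  refine Subtype.ext (HDGField.ext ?_ ?_ ?_ ?_ ?_)
  · ext K j x i
    exact congrFun (congrArg Subtype.val (congrFun (congrFun (congrFun h1 K) j) i)) x
  · ext F j x i
    exact congrFun (congrArg Subtype.val (congrFun (congrFun (congrFun h2 F) j) i)) x
  · ext K x i j
    exact congrFun (congrArg Subtype.val (congrFun (congrFun (congrFun h3 K) i) j)) x
  · ext K x
    exact congrFun (congrArg Subtype.val (congrFun h4 K)) x
  · ext K x
    exact congrFun (congrArg Subtype.val (congrFun h5 K)) x

namespace MemSpace

variable {k : ℕ} {X : HDGField M}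

theorem contDiff_vel (hX : X.MemSpace k) (K : M.elems) (j : Fin 3) :
    ContDiff ℝ 1 (X.vel K j) :=
  contDiff_euclidean.2 fun i => Mesh.contDiff_of_mem_poly (hX.vel K j i)

theorem continuous_vel (hX : X.MemSpace k) (K : M.elems) (j : Fin 3) :
    Continuous (X.vel K j) := (hX.contDiff_vel K j).continuous

theorem continuousOn_velHat (hX : X.MemSpace k) (F : M.faces) (j : Fin 3) :
    ContinuousOn (X.velHat F j) F.1 := by
  have h : ContinuousOn (fun x => (X.velHat F j x).ofLp) F.1 :=
    continuousOn_pi.2 fun i => Mesh.continuousOn_of_mem_facePoly (hX.velHat F j i)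
  exact (PiLp.continuous_toLp 2 (fun _ : Fin d => ℝ)).comp_continuousOn h

theorem continuous_stress (hX : X.MemSpace k) (K : M.elems) (i j : Fin d) :
    Continuous fun x => (X.stress K x).1 i j := Mesh.continuous_of_mem_poly (hX.stress K i j)

theorem continuous_stress' (hX : X.MemSpace k) (K : M.elems) : Continuous (X.stress K) :=
  continuous_induced_rng.2
    (continuous_pi fun i => continuous_pi fun j => hX.continuous_stress K i j)

theorem continuous_pres (hX : X.MemSpace k) (K : M.elems) : Continuous (X.pres K) :=
  Mesh.continuous_of_mem_poly (hX.pres K)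

theorem continuous_temp (hX : X.MemSpace k) (K : M.elems) : Continuous (X.temp K) :=
  Mesh.continuous_of_mem_poly (hX.temp K)

theorem continuous_totalStress (hX : X.MemSpace k) (P : Params d) (K : M.elems) :
    Continuous (totalStress P X K) := by
  refine continuous_pi fun i => continuous_pi fun j => ?_
  have h1 := hX.continuous_stress K i j
  have h2 := hX.continuous_pres K
  have h3 := hX.continuous_temp K
  simp only [totalStress, Matrix.sub_apply, Matrix.smul_apply, smul_eq_mul]
  fun_prop

theorem continuous_grad (hX : X.MemSpace k) (K : M.elems) (l : Fin 3) (i j : Fin d) :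
    Continuous fun x => grad (X.vel K l) x i j := by
  have h : Continuous fun x => fderiv ℝ (X.vel K l) x (EuclideanSpace.single j 1) :=
    ((hX.contDiff_vel K l).continuous_fderiv (by norm_num)).clm_apply continuous_const
  exact (EuclideanSpace.proj (𝕜 := ℝ) i).continuous.comp h

theorem continuous_strain (hX : X.MemSpace k) (K : M.elems) (l : Fin 3) :
    Continuous (strain (X.vel K l)) := by
  refine continuous_pi fun i => continuous_pi fun j => ?_
  have h1 := hX.continuous_grad K l i j
  have h2 := hX.continuous_grad K l j i
  simp only [strain, Matrix.smul_apply, Matrix.add_apply, Matrix.transpose_apply]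
  fun_prop

theorem continuous_dvg (hX : X.MemSpace k) (K : M.elems) (l : Fin 3) :
    Continuous (dvg (X.vel K l)) :=
  continuous_finsetSum _ fun i _ => hX.continuous_grad K l i i

end MemSpace

end HDGField

/-! ### Pointwise linear operations on the discrete space -/

theorem grad_add {v w : Pt d → Pt d} (hv : ContDiff ℝ 1 v) (hw : ContDiff ℝ 1 w) (x : Pt d) :
    grad (v + w) x = grad v x + grad w x := by
  ext i j
  simp only [grad, Matrix.add_apply]
  rw [fderiv_add (hv.differentiable (by norm_num) x) (hw.differentiable (by norm_num) x)]
  rfl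

theorem grad_smul (c : ℝ) {v : Pt d → Pt d} (hv : ContDiff ℝ 1 v) (x : Pt d) :
    grad (c • v) x = c • grad v x := by
  ext i j
  simp only [grad, Matrix.smul_apply]
  rw [fderiv_const_smul (hv.differentiable (by norm_num) x)]
  rfl

open HDGField

variable (k : ℕ)

/-- The value at `x` of the total stress, as a linear map on the discrete space. -/
def totalStressₗ (P : Params d) (K : M.elems) (x : Pt d) :
    space M k →ₗ[ℝ] Matrix (Fin d) (Fin d) ℝ where
  toFun X := totalStress P X.1 K x
  map_add' X Y := by
    ext i j
    simp [totalStress]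
    ring
  map_smul' c X := by
    ext i j
    simp [totalStress]
    ring

/-- The value at `x` of the Jacobian matrix of a volume column. -/
noncomputable def gradₗ (K : M.elems) (l : Fin 3) (x : Pt d) :
    space M k →ₗ[ℝ] Matrix (Fin d) (Fin d) ℝ where
  toFun X := grad (X.1.vel K l) x
  map_add' X Y := grad_add (X.2.contDiff_vel K l) (Y.2.contDiff_vel K l) x
  map_smul' c X := grad_smul c (X.2.contDiff_vel K l) x

/-- The value at `x` of the strain of a volume column. -/
noncomputable def strainₗ (K : M.elems) (l : Fin 3) (x : Pt d) :
    space M k →ₗ[ℝ] Matrix (Fin d) (Fin d) ℝ where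
  toFun X := strain (X.1.vel K l) x
  map_add' X Y := by
    have h := (gradₗ k K l x).map_add X Y
    change grad ((X + Y).1.vel K l) x = grad (X.1.vel K l) x + grad (Y.1.vel K l) x at h
    simp only [strain, h, Matrix.transpose_add, ← smul_add]
    congr 1
    abel
  map_smul' c X := by
    have h := (gradₗ k K l x).map_smul c X
    change grad ((c • X).1.vel K l) x = c • grad (X.1.vel K l) x at h
    simp only [strain, h, Matrix.transpose_smul, ← smul_add, RingHom.id_apply]
    rw [smul_comm]

/-- The value at `x` of the divergence of a volume column. -/
noncomputable def dvgₗ (K : M.elems) (l : Fin 3) (x : Pt d) : space M k →ₗ[ℝ] ℝ where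
  toFun X := dvg (X.1.vel K l) x
  map_add' X Y := by
    have h := (gradₗ k K l x).map_add X Y
    change grad ((X + Y).1.vel K l) x = grad (X.1.vel K l) x + grad (Y.1.vel K l) x at h
    simp only [dvg, h, Matrix.add_apply, Finset.sum_add_distrib]
  map_smul' c X := by
    have h := (gradₗ k K l x).map_smul c X
    change grad ((c • X).1.vel K l) x = c • grad (X.1.vel K l) x at h
    simp only [dvg, h, Matrix.smul_apply, Finset.smul_sum, RingHom.id_apply]

/-! ### Bilinear forms on the discrete space -/

variable {k}

theorem isBilinearMap_volSum {f : space M k → space M k → M.elems → Pt d → ℝ}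
    (hf : ∀ K x, IsBilinearMap ℝ fun X Y => f X Y K x)
    (hc : ∀ X Y K, Continuous (f X Y K)) : IsBilinearMap ℝ fun X Y => volSum M (f X Y) where
  add_left X X' Y := by
    simp only [volSum, ← Finset.sum_add_distrib]
    refine Finset.sum_congr rfl fun K _ => ?_
    rw [← integral_add (Mesh.integrable_elem K (hc X Y K)) (Mesh.integrable_elem K (hc X' Y K))]
    simp only [(hf K _).add_left]
  smul_left c X Y := by
    simp only [volSum, Finset.smul_sum]
    refine Finset.sum_congr rfl fun K _ => ?_
    rw [← integral_smul]
    simp only [(hf K _).smul_left]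
  add_right X Y Y' := by
    simp only [volSum, ← Finset.sum_add_distrib]
    refine Finset.sum_congr rfl fun K _ => ?_
    rw [← integral_add (Mesh.integrable_elem K (hc X Y K)) (Mesh.integrable_elem K (hc X Y' K))]
    simp only [(hf K _).add_right]
  smul_right c X Y := by
    simp only [volSum, Finset.smul_sum]
    refine Finset.sum_congr rfl fun K _ => ?_
    rw [← integral_smul]
    simp only [(hf K _).smul_right]

theorem isBilinearMap_bdrySum {f : space M k → space M k → M.elems → M.faces → Pt d → ℝ}
    (hf : ∀ K F x, IsBilinearMap ℝ fun X Y => f X Y K F x)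
    (hc : ∀ X Y K (F : M.faces), ContinuousOn (f X Y K F) F.1) :
    IsBilinearMap ℝ fun X Y => bdrySum M (f X Y) where
  add_left X X' Y := by
    simp only [bdrySum, ← Finset.sum_add_distrib]
    refine Finset.sum_congr rfl fun K _ => Finset.sum_congr rfl fun F _ => ?_
    rw [← integral_add (Mesh.integrable_face F (hc X Y K F))
      (Mesh.integrable_face F (hc X' Y K F))]
    simp only [(hf K F _).add_left]
  smul_left c X Y := by
    simp only [bdrySum, Finset.smul_sum]
    refine Finset.sum_congr rfl fun K _ => Finset.sum_congr rfl fun F _ => ?_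
    rw [← integral_smul]
    simp only [(hf K F _).smul_left]
  add_right X Y Y' := by
    simp only [bdrySum, ← Finset.sum_add_distrib]
    refine Finset.sum_congr rfl fun K _ => Finset.sum_congr rfl fun F _ => ?_
    rw [← integral_add (Mesh.integrable_face F (hc X Y K F))
      (Mesh.integrable_face F (hc X Y' K F))]
    simp only [(hf K F _).add_right]
  smul_right c X Y := by
    simp only [bdrySum, Finset.smul_sum]
    refine Finset.sum_congr rfl fun K _ => Finset.sum_congr rfl fun F _ => ?_
    rw [← integral_smul]
    simp only [(hf K F _).smul_right]

section BilinearMap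

variable {V : Type*} [AddCommGroup V] [Module ℝ V]

theorem isBilinearMap_add {f g : V → V → ℝ} (hf : IsBilinearMap ℝ f) (hg : IsBilinearMap ℝ g) :
    IsBilinearMap ℝ fun X Y => f X Y + g X Y :=
  ⟨fun X X' Y => by rw [hf.add_left, hg.add_left]; ring,
    fun c X Y => by rw [hf.smul_left, hg.smul_left, smul_add],
    fun X Y Y' => by rw [hf.add_right, hg.add_right]; ring,
    fun c X Y => by rw [hf.smul_right, hg.smul_right, smul_add]⟩

theorem isBilinearMap_const_mul (a : ℝ) {f : V → V → ℝ} (hf : IsBilinearMap ℝ f) :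
    IsBilinearMap ℝ fun X Y => a * f X Y :=
  ⟨fun X X' Y => by rw [hf.add_left, mul_add],
    fun c X Y => by rw [hf.smul_left, smul_eq_mul, smul_eq_mul]; ring,
    fun X Y Y' => by rw [hf.add_right, mul_add],
    fun c X Y => by rw [hf.smul_right, smul_eq_mul, smul_eq_mul]; ring⟩

theorem isBilinearMap_neg {f : V → V → ℝ} (hf : IsBilinearMap ℝ f) :
    IsBilinearMap ℝ fun X Y => -f X Y := by
  simpa using isBilinearMap_const_mul (-1) hf

theorem isBilinearMap_sub {f g : V → V → ℝ} (hf : IsBilinearMap ℝ f) (hg : IsBilinearMap ℝ g) :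
    IsBilinearMap ℝ fun X Y => f X Y - g X Y := by
  simpa [sub_eq_add_neg] using isBilinearMap_add hf (isBilinearMap_neg hg)

theorem isBilinearMap_sum {ι : Type*} (s : Finset ι) {f : ι → V → V → ℝ}
    (hf : ∀ i, IsBilinearMap ℝ (f i)) : IsBilinearMap ℝ fun X Y => ∑ i ∈ s, f i X Y :=
  ⟨fun X X' Y => by simp only [(hf _).add_left, Finset.sum_add_distrib],
    fun c X Y => by simp only [(hf _).smul_left, Finset.smul_sum],
    fun X Y Y' => by simp only [(hf _).add_right, Finset.sum_add_distrib],
    fun c X Y => by simp only [(hf _).smul_right, Finset.smul_sum]⟩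

theorem isBilinearMap_swap {f : V → V → ℝ} (hf : IsBilinearMap ℝ f) :
    IsBilinearMap ℝ fun X Y => f Y X :=
  ⟨fun _ _ _ => hf.add_right _ _ _, fun _ _ _ => hf.smul_right _ _ _,
    fun _ _ _ => hf.add_left _ _ _, fun _ _ _ => hf.smul_left _ _ _⟩

theorem isBilinearMap_mul {f g : V → ℝ} (hf : IsLinearMap ℝ f) (hg : IsLinearMap ℝ g) :
    IsBilinearMap ℝ fun X Y => f X * g Y :=
  ⟨fun X X' Y => by rw [hf.map_add, add_mul],
    fun c X Y => by rw [hf.map_smul, smul_eq_mul, smul_eq_mul, mul_assoc],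
    fun X Y Y' => by rw [hg.map_add, mul_add],
    fun c X Y => by rw [hg.map_smul, smul_eq_mul, smul_eq_mul, mul_left_comm]⟩

theorem isBilinearMap_inner {f g : V → Pt d} (hf : IsLinearMap ℝ f) (hg : IsLinearMap ℝ g) :
    IsBilinearMap ℝ fun X Y => ⟪f X, g Y⟫ :=
  ⟨fun X X' Y => by rw [hf.map_add, inner_add_left],
    fun c X Y => by rw [hf.map_smul, real_inner_smul_left, smul_eq_mul],
    fun X Y Y' => by rw [hg.map_add, inner_add_right],
    fun c X Y => by rw [hg.map_smul, real_inner_smul_right, smul_eq_mul]⟩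

theorem isBilinearMap_frob {f g : V → Matrix (Fin d) (Fin d) ℝ} (hf : IsLinearMap ℝ f)
    (hg : IsLinearMap ℝ g) : IsBilinearMap ℝ fun X Y => frob (f X) (g Y) :=
  isBilinearMap_sum _ fun i => isBilinearMap_sum _ fun j => isBilinearMap_mul
    ⟨fun X X' => by rw [hf.map_add]; rfl, fun c X => by rw [hf.map_smul]; rfl⟩
    ⟨fun X X' => by rw [hg.map_add]; rfl, fun c X => by rw [hg.map_smul]; rfl⟩

end BilinearMap

theorem isLinearMap_vel (K : M.elems) (j : Fin 3) (x : Pt d) :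
    IsLinearMap ℝ fun X : space M k => X.1.vel K j x := ⟨fun _ _ => rfl, fun _ _ => rfl⟩

theorem isLinearMap_jump (K : M.elems) (F : M.faces) (j : Fin 3) (x : Pt d) :
    IsLinearMap ℝ fun X : space M k => X.1.vel K j x - X.1.velHat F j x :=
  ⟨fun _ _ => add_sub_add_comm _ _ _ _,
    fun c X => (smul_sub c (X.1.vel K j x) (X.1.velHat F j x)).symm⟩

theorem isLinearMap_pres (K : M.elems) (x : Pt d) :
    IsLinearMap ℝ fun X : space M k => X.1.pres K x := ⟨fun _ _ => rfl, fun _ _ => rfl⟩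

theorem isLinearMap_temp (K : M.elems) (x : Pt d) :
    IsLinearMap ℝ fun X : space M k => X.1.temp K x := ⟨fun _ _ => rfl, fun _ _ => rfl⟩

end Space

section FormsBilinear

open HDGField

variable {d : ℕ} {Ω : Set (Pt d)} {M : Mesh Ω} {k : ℕ}

theorem isLinearMap_act {V : Type*} [AddCommGroup V] [Module ℝ V]
    {f : V → Matrix (Fin d) (Fin d) ℝ} (hf : IsLinearMap ℝ f) (n : Pt d) :
    IsLinearMap ℝ fun X => act (f X) n :=
  ⟨fun X Y => by rw [hf.map_add, act, Matrix.add_mulVec]; rfl,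
    fun c X => by rw [hf.map_smul, act, Matrix.smul_mulVec]; rfl⟩

theorem isLinearMap_smul_const {V : Type*} [AddCommGroup V] [Module ℝ V] {f : V → ℝ}
    (hf : IsLinearMap ℝ f) (n : Pt d) : IsLinearMap ℝ fun X => f X • n :=
  ⟨fun X Y => by rw [hf.map_add, add_smul],
    fun c X => by rw [hf.map_smul, smul_eq_mul, mul_smul]⟩

theorem continuous_frob {f g : Pt d → Matrix (Fin d) (Fin d) ℝ} (hf : Continuous f)
    (hg : Continuous g) : Continuous fun x => frob (f x) (g x) :=
  continuous_finsetSum _ fun i _ => continuous_finsetSum _ fun j _ =>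
    (hf.matrix_elem i j).mul (hg.matrix_elem i j)

theorem continuous_act {f : Pt d → Matrix (Fin d) (Fin d) ℝ} (hf : Continuous f) (n : Pt d) :
    Continuous fun x => act (f x) n :=
  (PiLp.continuous_toLp 2 (fun _ : Fin d => ℝ)).comp (hf.matrix_mulVec continuous_const)

theorem continuous_compl (P : Params d) {f : Pt d → Sym d} (hf : Continuous f) :
    Continuous fun x => (P.compl (f x)).1 :=
  continuous_subtype_val.comp
    ((LinearMap.continuous_of_finiteDimensional P.compl.toLinearMap).comp hf)

theorem mulVec_Q_dotProduct (P : Params d) (a b a' b' : ℝ) :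
    P.Q.mulVec ![a, b] ⬝ᵥ ![a', b']
      = P.c0 * (a * a') + (-P.b0) * (b * a') + (-P.b0) * (a * b') + P.a0 * (b * b') := by
  simp [Params.Q, Matrix.mulVec, dotProduct, Fin.sum_univ_two]
  ring

variable (P : Params d)

theorem isBilinearMap_innerH1 :
    IsBilinearMap ℝ fun X Y : space M k => innerH1 P X.1 Y.1 := by
  refine isBilinearMap_volSum (fun K x => ?_) (fun X Y K => ?_)
  · exact isBilinearMap_sum _ fun j => isBilinearMap_sum _ fun l => isBilinearMap_const_mul _
      (isBilinearMap_inner (isLinearMap_vel K j x) (isLinearMap_vel K l x))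
  · exact continuous_finsetSum _ fun j _ => continuous_finsetSum _ fun l _ =>
      continuous_const.mul ((X.2.continuous_vel K j).inner (Y.2.continuous_vel K l))

theorem isBilinearMap_innerH2 :
    IsBilinearMap ℝ fun X Y : space M k => innerH2 P X.1 Y.1 := by
  refine isBilinearMap_volSum (fun K x => ?_) (fun X Y K => ?_)
  · simp only [mulVec_Q_dotProduct]
    have hp := isLinearMap_pres (k := k) K x
    have ht := isLinearMap_temp (k := k) K x
    refine isBilinearMap_add (isBilinearMap_frob ?_ ?_) (isBilinearMap_add (isBilinearMap_add
      (isBilinearMap_add ?_ ?_) ?_) ?_)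
    · exact ⟨fun X Y => congrArg Subtype.val (P.compl.map_add (X.1.stress K x) (Y.1.stress K x)),
        fun c X => congrArg Subtype.val (P.compl.map_smul c (X.1.stress K x))⟩
    · exact ⟨fun _ _ => rfl, fun _ _ => rfl⟩
    · exact isBilinearMap_const_mul _ (isBilinearMap_mul hp hp)
    · exact isBilinearMap_const_mul _ (isBilinearMap_mul ht hp)
    · exact isBilinearMap_const_mul _ (isBilinearMap_mul hp ht)
    · exact isBilinearMap_const_mul _ (isBilinearMap_mul ht ht)
  · simp only [mulVec_Q_dotProduct]
    have h1 := continuous_frob (continuous_compl P (X.2.continuous_stress' K))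
      (continuous_subtype_val.comp (Y.2.continuous_stress' K))
    have h2 := X.2.continuous_pres K
    have h3 := X.2.continuous_temp K
    have h4 := Y.2.continuous_pres K
    have h5 := Y.2.continuous_temp K
    exact h1.add (by fun_prop)

theorem isBilinearMap_damping :
    IsBilinearMap ℝ fun X Y : space M k => damping P X.1 Y.1 := by
  refine isBilinearMap_volSum (fun K x => ?_) (fun X Y K => ?_)
  · exact isBilinearMap_add
      (isBilinearMap_const_mul _ (isBilinearMap_inner (isLinearMap_vel K 1 x)
        (isLinearMap_vel K 1 x)))
      (isBilinearMap_const_mul _ (isBilinearMap_inner (isLinearMap_vel K 2 x)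
        (isLinearMap_vel K 2 x)))
  · exact (continuous_const.mul ((X.2.continuous_vel K 1).inner (Y.2.continuous_vel K 1))).add
      (continuous_const.mul ((X.2.continuous_vel K 2).inner (Y.2.continuous_vel K 2)))

theorem isBilinearMap_formB :
    IsBilinearMap ℝ fun X Y : space M k => formB P X.1 Y.1 := by
  refine isBilinearMap_add (isBilinearMap_volSum (fun K x => ?_) (fun X Y K => ?_))
    (isBilinearMap_bdrySum (fun K F x => ?_) (fun X Y K F => ?_))
  · exact isBilinearMap_sub (isBilinearMap_sub
      (isBilinearMap_frob (totalStressₗ k P K x).isLinear (strainₗ k K 0 x).isLinear)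
      (isBilinearMap_mul (isLinearMap_pres K x) (dvgₗ k K 1 x).isLinear))
      (isBilinearMap_mul (isLinearMap_temp K x) (dvgₗ k K 2 x).isLinear)
  · exact ((continuous_frob (X.2.continuous_totalStress P K) (Y.2.continuous_strain K 0)).sub
      ((X.2.continuous_pres K).mul (Y.2.continuous_dvg K 1))).sub
      ((X.2.continuous_temp K).mul (Y.2.continuous_dvg K 2))
  · exact isBilinearMap_add (isBilinearMap_add
      (isBilinearMap_neg (isBilinearMap_inner
        (isLinearMap_act (totalStressₗ k P K x).isLinear _) (isLinearMap_jump K F 0 x)))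
      (isBilinearMap_inner (isLinearMap_smul_const (isLinearMap_pres K x) _)
        (isLinearMap_jump K F 1 x)))
      (isBilinearMap_inner (isLinearMap_smul_const (isLinearMap_temp K x) _)
        (isLinearMap_jump K F 2 x))
  · have h : ∀ j, ContinuousOn (fun x => Y.1.vel K j x - Y.1.velHat F j x) F.1 := fun j =>
      (Y.2.continuous_vel K j).continuousOn.sub (Y.2.continuousOn_velHat F j)
    exact (((continuous_act (X.2.continuous_totalStress P K) _).continuousOn.inner (h 0)).neg.add
      (((X.2.continuous_pres K).smul continuous_const).continuousOn.inner (h 1))).add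
      (((X.2.continuous_temp K).smul continuous_const).continuousOn.inner (h 2))

theorem isBilinearMap_stab :
    IsBilinearMap ℝ fun X Y : space M k => stab k X.1 Y.1 := by
  refine isBilinearMap_bdrySum (fun K F x => ?_) (fun X Y K F => ?_)
  · exact isBilinearMap_const_mul _ (isBilinearMap_sum _ fun j => isBilinearMap_inner
      (isLinearMap_jump K F j x) (isLinearMap_jump K F j x))
  · have h : ∀ (Z : space M k) j,
        ContinuousOn (fun x => Z.1.vel K j x - Z.1.velHat F j x) F.1 := fun Z j =>
      (Z.2.continuous_vel K j).continuousOn.sub (Z.2.continuousOn_velHat F j)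
    exact continuousOn_const.mul (continuousOn_finsetSum _ fun j _ => (h X j).inner (h Y j))

variable (M k)

/-- The mass form `(u, v)_{H₁} + (Θ, Φ)_{H₂}`. -/
noncomputable def massForm : space M k →ₗ[ℝ] space M k →ₗ[ℝ] ℝ :=
  (isBilinearMap_add (isBilinearMap_innerH1 P) (isBilinearMap_innerH2 P)).toLinearMap

/-- The part of the scheme without time derivatives. -/
noncomputable def steadyForm : space M k →ₗ[ℝ] space M k →ₗ[ℝ] ℝ :=
  (isBilinearMap_add (isBilinearMap_sub (isBilinearMap_add (isBilinearMap_damping P)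
    (isBilinearMap_formB P)) (isBilinearMap_swap (isBilinearMap_formB P)))
    isBilinearMap_stab).toLinearMap

variable {M k}

theorem massForm_apply (X Y : space M k) :
    massForm M k P X Y = innerH1 P X.1 Y.1 + innerH2 P X.1 Y.1 := rfl

theorem steadyForm_apply (X Y : space M k) : steadyForm M k P X Y
    = damping P X.1 Y.1 + formB P X.1 Y.1 - formB P Y.1 X.1 + stab k X.1 Y.1 := rfl

theorem schemeLHS_eq (X X' Y : space M k) :
    schemeLHS P k X.1 X'.1 Y.1 = massForm M k P X' Y + steadyForm M k P X Y := by
  rw [massForm_apply, steadyForm_apply, schemeLHS]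
  ring

end FormsBilinear

/-! ### Positivity of the mass form -/

namespace Params

variable {d : ℕ} (P : Params d)

theorem rho_pos : 0 < P.rho := by
  have h1 := P.phi_mem.1
  have h2 := P.phi_mem.2
  have h3 := mul_pos h1 P.rhoF_pos
  have h4 := mul_pos (sub_pos.2 h2) P.rhoS_pos
  simp only [rho]
  linarith

/-- The density block of `R` is positive definite because `ν > 1`. -/
theorem rhoF_sq_lt : P.rhoF ^ 2 < P.rho * P.rhoW := by
  have h1 := P.phi_mem.1
  have h2 := P.phi_mem.2
  have hF := P.rhoF_pos
  have h4 := mul_pos (sub_pos.2 h2) P.rhoS_pos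
  have h5 : 0 < P.rhoW := mul_pos (div_pos (by linarith [P.nu_gt]) h1) hF
  have h6 : P.phi * P.rhoF * P.rhoW = P.nu * P.rhoF ^ 2 := by
    rw [rhoW]
    field_simp
  have h7 : P.rho * P.rhoW = P.nu * P.rhoF ^ 2 + (1 - P.phi) * P.rhoS * P.rhoW := by
    rw [← h6, rho]; ring
  have h8 := mul_pos h4 h5
  have h9 : P.rhoF ^ 2 < P.nu * P.rhoF ^ 2 := lt_mul_of_one_lt_left (by positivity) P.nu_gt
  linarith

/-- Completion of the square in the density block. -/
theorem sum_R_inner (u : Fin 3 → Pt d) : ∑ j, ∑ l, P.R j l * ⟪u j, u l⟫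
    = P.rho * ‖u 0 + (P.rhoF / P.rho) • u 1‖ ^ 2
      + (P.rhoW - P.rhoF ^ 2 / P.rho) * ‖u 1‖ ^ 2 + P.tau / P.chi * ‖u 2‖ ^ 2 := by
  have h := P.rho_pos.ne'
  simp only [R, Fin.sum_univ_three, ← real_inner_self_eq_norm_sq, inner_add_left, inner_add_right,
    real_inner_smul_left, real_inner_smul_right, real_inner_comm (u 0) (u 1)]
  simp
  field_simp
  ring

theorem sum_R_inner_nonneg (u : Fin 3 → Pt d) : 0 ≤ ∑ j, ∑ l, P.R j l * ⟪u j, u l⟫ := by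
  rw [sum_R_inner]
  have h1 := P.rho_pos
  have h2 : 0 < P.rhoW - P.rhoF ^ 2 / P.rho := by
    rw [sub_pos, div_lt_iff₀ h1, mul_comm]; exact P.rhoF_sq_lt
  have h3 := div_pos P.tau_pos P.chi_pos
  positivity

theorem eq_zero_of_sum_R_inner (u : Fin 3 → Pt d) (h : ∑ j, ∑ l, P.R j l * ⟪u j, u l⟫ = 0) :
    u = 0 := by
  rw [sum_R_inner] at h
  have h1 := P.rho_pos
  have h2 : 0 < P.rhoW - P.rhoF ^ 2 / P.rho := by
    rw [sub_pos, div_lt_iff₀ h1, mul_comm]; exact P.rhoF_sq_lt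
  have h3 := div_pos P.tau_pos P.chi_pos
  have a1 := mul_nonneg h1.le (sq_nonneg ‖u 0 + (P.rhoF / P.rho) • u 1‖)
  have a2 := mul_nonneg h2.le (sq_nonneg ‖u 1‖)
  have a3 := mul_nonneg h3.le (sq_nonneg ‖u 2‖)
  have b2 : u 1 = 0 := by
    have : (P.rhoW - P.rhoF ^ 2 / P.rho) * ‖u 1‖ ^ 2 = 0 := by linarith
    simpa [h2.ne'] using this
  have b3 : u 2 = 0 := by
    have : P.tau / P.chi * ‖u 2‖ ^ 2 = 0 := by linarith
    rcases mul_eq_zero.1 this with h | h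
    · exact absurd h h3.ne'
    · simpa using h
  have b1 : u 0 = 0 := by
    have : P.rho * ‖u 0 + (P.rhoF / P.rho) • u 1‖ ^ 2 = 0 := by linarith
    simpa [h1.ne', b2] using this
  ext1 j
  fin_cases j
  · exact b1
  · exact b2
  · exact b3

theorem frob_self_nonneg (A : Matrix (Fin d) (Fin d) ℝ) : 0 ≤ frob A A :=
  Finset.sum_nonneg fun _ _ => Finset.sum_nonneg fun _ _ => mul_self_nonneg _

theorem eq_zero_of_frob_self {A : Matrix (Fin d) (Fin d) ℝ} (h : frob A A = 0) : A = 0 := by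
  ext i j
  have h4 : ∀ i ∈ Finset.univ, 0 ≤ ∑ j, A i j * A i j := fun i _ =>
    Finset.sum_nonneg fun j _ => mul_self_nonneg _
  have h6 := (Finset.sum_eq_zero_iff_of_nonneg h4).1 h i (Finset.mem_univ i)
  have h7 := (Finset.sum_eq_zero_iff_of_nonneg fun j _ => mul_self_nonneg _).1 h6 j
    (Finset.mem_univ j)
  simpa using h7

theorem frob_comm (A B : Matrix (Fin d) (Fin d) ℝ) : frob A B = frob B A := by
  simp only [frob, mul_comm]

theorem elast_compl (S : Sym d) : P.elast (P.compl S) = S :=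
  (LinearEquiv.ofInjectiveEndo P.elast P.elast_injective).apply_symm_apply S

theorem frob_compl_nonneg (S : Sym d) : 0 ≤ frob (P.compl S).1 S.1 := by
  obtain ⟨cm, cp, h0, -, h⟩ := P.elast_bounds
  have h1 := (h (P.compl S)).1
  rw [elast_compl, frob_comm S.1] at h1
  exact (mul_nonneg h0.le (frob_self_nonneg _)).trans h1

theorem eq_zero_of_frob_compl {S : Sym d} (hS : frob (P.compl S).1 S.1 = 0) : S = 0 := by
  obtain ⟨cm, cp, h0, -, h⟩ := P.elast_bounds
  have h1 := (h (P.compl S)).1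
  rw [elast_compl, frob_comm S.1, hS] at h1
  have h2 : frob (P.compl S).1 (P.compl S).1 = 0 :=
    le_antisymm (by by_contra hc; exact absurd h1 (not_le.2 (mul_pos h0 (not_le.1 hc))))
      (frob_self_nonneg _)
  have h3 : P.compl S = 0 := Subtype.ext (eq_zero_of_frob_self h2)
  simpa using h3

theorem Q_form (a b : ℝ) : P.Q.mulVec ![a, b] ⬝ᵥ ![a, b]
    = P.c0 * (a - P.b0 / P.c0 * b) ^ 2 + (P.a0 * P.c0 - P.b0 ^ 2) / P.c0 * b ^ 2 := by
  have h := P.c0_pos.ne'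
  rw [mulVec_Q_dotProduct]
  field_simp
  ring

theorem Q_form_nonneg (a b : ℝ) : 0 ≤ P.Q.mulVec ![a, b] ⬝ᵥ ![a, b] := by
  rw [Q_form]
  have h1 := P.c0_pos
  have h2 := div_pos P.det_pos h1
  positivity

theorem eq_zero_of_Q_form {a b : ℝ} (h : P.Q.mulVec ![a, b] ⬝ᵥ ![a, b] = 0) :
    a = 0 ∧ b = 0 := by
  rw [Q_form] at h
  have h1 := P.c0_pos
  have h2 := div_pos P.det_pos h1
  have a1 := mul_nonneg h1.le (sq_nonneg (a - P.b0 / P.c0 * b))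
  have a2 := mul_nonneg h2.le (sq_nonneg b)
  have hb : b = 0 := by
    have : (P.a0 * P.c0 - P.b0 ^ 2) / P.c0 * b ^ 2 = 0 := by linarith
    exact pow_eq_zero_iff (two_ne_zero) |>.1 ((mul_eq_zero.1 this).resolve_left h2.ne')
  have ha : P.c0 * (a - P.b0 / P.c0 * b) ^ 2 = 0 := by linarith
  have := pow_eq_zero_iff (two_ne_zero) |>.1 ((mul_eq_zero.1 ha).resolve_left h1.ne')
  exact ⟨by simpa [hb] using this, hb⟩

end Params

section

open HDGField

variable {d : ℕ} {Ω : Set (Pt d)} {M : Mesh Ω} {k : ℕ}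

variable (M k) in
/-- The discrete fields whose volume components vanish. -/
def hatSpace : Submodule ℝ (space M k) where
  carrier := {X | X.1.vel = 0 ∧ X.1.stress = 0 ∧ X.1.pres = 0 ∧ X.1.temp = 0}
  add_mem' {X Y} hX hY := by
    obtain ⟨h1, h2, h3, h4⟩ := hX
    obtain ⟨g1, g2, g3, g4⟩ := hY
    exact ⟨by simp [h1, g1], by simp [h2, g2], by simp [h3, g3], by simp [h4, g4]⟩
  zero_mem' := ⟨rfl, rfl, rfl, rfl⟩
  smul_mem' c X hX := by
    obtain ⟨h1, h2, h3, h4⟩ := hX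
    exact ⟨by simp [h1], by simp [h2], by simp [h3], by simp [h4]⟩

theorem volSum_nonneg {f : M.elems → Pt d → ℝ} (h : ∀ K x, 0 ≤ f K x) : 0 ≤ volSum M f :=
  Finset.sum_nonneg fun K _ => integral_nonneg (h K)

theorem eq_zero_of_volSum (hΩ : IsOpen Ω) {f : M.elems → Pt d → ℝ} (h : ∀ K x, 0 ≤ f K x)
    (hc : ∀ K, Continuous (f K)) (h0 : volSum M f = 0) (K : M.elems) :
    ∀ x ∈ interior K.1 ∩ Ω, f K x = 0 :=
  Mesh.eq_zero_of_integral_elem hΩ K (hc K) (h K)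
    ((Finset.sum_eq_zero_iff_of_nonneg fun K _ => integral_nonneg (h K)).1 h0 K (Finset.mem_univ K))

variable (P : Params d)

/-- The mass form only vanishes on fields without volume components. Its integrand vanishes
pointwise on an open part of each element, and polynomials are determined there. -/
theorem mem_hatSpace_of_massForm (hΩ : IsOpen Ω) {X : space M k}
    (h : massForm M k P X X = 0) : X ∈ hatSpace M k := by
  have n1 : ∀ (K : M.elems) x, 0 ≤ ∑ j, ∑ l, P.R j l * ⟪X.1.vel K j x, X.1.vel K l x⟫ :=
    fun K x => P.sum_R_inner_nonneg fun j => X.1.vel K j x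
  have n2 : ∀ (K : M.elems) x, 0 ≤ frob (P.compl (X.1.stress K x)).1 (X.1.stress K x).1
      + P.Q.mulVec ![X.1.pres K x, X.1.temp K x] ⬝ᵥ ![X.1.pres K x, X.1.temp K x] :=
    fun K x => add_nonneg (P.frob_compl_nonneg _) (P.Q_form_nonneg _ _)
  rw [massForm_apply] at h
  have e1 : innerH1 P X.1 X.1 = 0 := by
    have := volSum_nonneg n1
    have := volSum_nonneg n2
    simp only [innerH1, innerH2] at h ⊢
    linarith
  have e2 : innerH2 P X.1 X.1 = 0 := by linarith
  have z1 := eq_zero_of_volSum hΩ n1 (fun K => continuous_finsetSum _ fun j _ =>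
    continuous_finsetSum _ fun l _ =>
      continuous_const.mul ((X.2.continuous_vel K j).inner (X.2.continuous_vel K l))) e1
  have z2 := eq_zero_of_volSum hΩ n2 (fun K => by
    have h1 := continuous_frob (continuous_compl P (X.2.continuous_stress' K))
      (continuous_subtype_val.comp (X.2.continuous_stress' K))
    have h2 := X.2.continuous_pres K
    have h3 := X.2.continuous_temp K
    simp only [mulVec_Q_dotProduct]
    exact h1.add (by fun_prop)) e2
  have z3 : ∀ (K : M.elems), ∀ x ∈ interior K.1 ∩ Ω,
      X.1.stress K x = 0 ∧ X.1.pres K x = 0 ∧ X.1.temp K x = 0 := fun K x hx => by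
    have := z2 K x hx
    have p1 := P.frob_compl_nonneg (X.1.stress K x)
    have p2 := P.Q_form_nonneg (X.1.pres K x) (X.1.temp K x)
    exact ⟨P.eq_zero_of_frob_compl (by linarith), P.eq_zero_of_Q_form (by linarith)⟩
  have hU : ∀ K : M.elems, IsOpen (interior K.1 ∩ Ω) := fun K => isOpen_interior.inter hΩ
  have hne := M.interior_elem_inter_nonempty
  refine ⟨?_, ?_, ?_, ?_⟩
  · ext K j x i
    refine congrFun (Mesh.eq_zero_of_mem_poly (X.2.vel K j i) (hU K) (hne K) fun y hy => ?_) x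
    have := congrFun (P.eq_zero_of_sum_R_inner _ (z1 K y hy)) j
    rw [this]
    rfl
  · ext K x i j
    refine congrFun (Mesh.eq_zero_of_mem_poly (X.2.stress K i j) (hU K) (hne K) fun y hy => ?_) x
    rw [(z3 K y hy).1]
    rfl
  · ext K x
    exact congrFun (Mesh.eq_zero_of_mem_poly (X.2.pres K) (hU K) (hne K)
      fun y hy => (z3 K y hy).2.1) x
  · ext K x
    exact congrFun (Mesh.eq_zero_of_mem_poly (X.2.temp K) (hU K) (hne K)
      fun y hy => (z3 K y hy).2.2) x

end

/-! ### Elimination of the face unknowns -/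

section Elimination

open HDGField

variable {d : ℕ} {Ω : Set (Pt d)} {M : Mesh Ω} {k : ℕ}

/-- The number of elements adjacent to a face. -/
noncomputable def adjCount (F : M.faces) : ℝ :=
  open Classical in ((Finset.univ.filter fun K : M.elems => F.1 ⊆ K.1).card : ℝ)

theorem adjCount_pos (F : M.faces) : 0 < adjCount F := by
  classical
  obtain ⟨K, hK⟩ := M.exists_elem_of_face F
  have : 0 < (Finset.univ.filter fun K : M.elems => F.1 ⊆ K.1).card :=
    Finset.card_pos.2 ⟨K, by simpa using hK⟩
  have h : (0 : ℝ) < ((Finset.univ.filter fun K : M.elems => F.1 ⊆ K.1).card : ℝ) := by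
    exact_mod_cast this
  rw [adjCount]
  convert! h

open Classical in
theorem adjCount_smul_faceMean (F : M.faces) (f : M.elems → Pt d) :
    adjCount F • faceMean F f = ∑ K : M.elems with F.1 ⊆ K.1, f K := by
  have h := (adjCount_pos F).ne'
  rw [adjCount] at h ⊢
  rw [faceMean, smul_smul, mul_inv_cancel₀ h, one_smul]

open Classical in
theorem bdrySum_eq_sum_faces (f : M.elems → M.faces → Pt d → ℝ)
    (hf : ∀ (K : M.elems) (F : M.faces), IntegrableOn (f K F) F.1 (surf d)) :
    bdrySum M f
      = ∑ F : M.faces, ∫ x in F.1, ∑ K : M.elems with F.1 ⊆ K.1, f K F x ∂(surf d) := by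
  rw [bdrySum, Finset.sum_comm' (t' := Finset.univ)
    (s' := fun F => Finset.univ.filter fun K : M.elems => F.1 ⊆ K.1) (by simp)]
  exact Finset.sum_congr rfl fun F _ => (integral_finsetSum _ fun K _ => hf K F).symm

theorem continuous_faceMean (F : M.faces) {f : M.elems → Pt d → Pt d}
    (hf : ∀ K, Continuous (f K)) : Continuous fun x => faceMean F fun K => f K x :=
  (continuous_finsetSum _ fun K _ => hf K).fun_const_smul _

variable (P : Params d)

theorem continuous_faceFlux (X : space M k) (F : M.faces) (j : Fin 3) :
    Continuous fun x => faceFlux P k X.1 F x j := by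
  have h1 := fun j => continuous_faceMean F fun K => X.2.continuous_vel K j
  have h2 := continuous_faceMean F fun K =>
    continuous_act (X.2.continuous_totalStress P K) (outwardNormal K.1 F.1)
  have h3 : Continuous fun x => faceMean F fun K => X.1.pres K x • outwardNormal K.1 F.1 :=
    continuous_faceMean F fun K => (X.2.continuous_pres K).smul continuous_const
  have h4 : Continuous fun x => faceMean F fun K => X.1.temp K x • outwardNormal K.1 F.1 :=
    continuous_faceMean F fun K => (X.2.continuous_temp K).smul continuous_const
  fin_cases j
  · exact (h1 0).sub (h2.fun_const_smul _)
  · exact (h1 1).add (h3.fun_const_smul _)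
  · exact (h1 2).add (h4.fun_const_smul _)

/-- The face residual: the defect of the elimination formula on `F`, tested with a face function. -/
noncomputable def faceResidual (X Y : HDGField M) (k : ℕ) (F : M.faces) : ℝ :=
  ∫ x in F.1, ∑ j, ⟪X.velHat F j x - faceFlux P k X F x j, Y.velHat F j x⟫ ∂(surf d)

/-- Tested with a pure face field, the steady form collects on each face the contributions of the
adjacent elements; the sum is the face residual, weighted by the number of these elements and the
stabilization parameter. -/
theorem steadyForm_hat (hd : 2 ≤ d) (X : space M k) {Y : space M k} (hY : Y ∈ hatSpace M k) :
    steadyForm M k P X Y = ∑ F : M.faces,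
      (adjCount F * (((k : ℝ) + 1) ^ 2 / Metric.diam F.1)) * faceResidual P X.1 Y.1 k F := by
  classical
  obtain ⟨h1, h2, h3, h4⟩ := hY
  -- only the face terms containing the test function survive
  have d0 : damping P X.1 Y.1 = 0 := by simp [damping, volSum, h1]
  have b0 : formB P Y.1 X.1 = 0 := by
    have : ∀ K x, totalStress P Y.1 K x = 0 := fun K x => by simp [totalStress, h2, h3, h4]
    simp [formB, volSum, bdrySum, this, h3, h4, frob, act]
  have v0 : ∀ K j, Y.1.vel K j = 0 := fun K j => by rw [h1]; rfl
  have g0 : ∀ x, grad (0 : Pt d → Pt d) x = 0 := fun x => by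
    ext i j
    simp [grad]
  let f1 : M.elems → M.faces → Pt d → ℝ := fun K F x =>
      - ⟪act (totalStress P X.1 K x) (outwardNormal K.1 F.1), Y.1.vel K 0 x - Y.1.velHat F 0 x⟫
      + ⟪X.1.pres K x • outwardNormal K.1 F.1, Y.1.vel K 1 x - Y.1.velHat F 1 x⟫
      + ⟪X.1.temp K x • outwardNormal K.1 F.1, Y.1.vel K 2 x - Y.1.velHat F 2 x⟫
  let f2 : M.elems → M.faces → Pt d → ℝ := fun K F x => ((k : ℝ) + 1) ^ 2 / Metric.diam F.1 *
    ∑ j, ⟪X.1.vel K j x - X.1.velHat F j x, Y.1.vel K j x - Y.1.velHat F j x⟫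
  have c : ∀ (Z : space M k) K (F : M.faces) j,
      ContinuousOn (fun x => Z.1.vel K j x - Z.1.velHat F j x) F.1 := fun Z K F j =>
    (Z.2.continuous_vel K j).continuousOn.sub (Z.2.continuousOn_velHat F j)
  have i1 : ∀ (K : M.elems) (F : M.faces), IntegrableOn (f1 K F) F.1 (surf d) := fun K F =>
    Mesh.integrable_face F
      ((((continuous_act (X.2.continuous_totalStress P K) _).continuousOn.inner (c Y K F 0)).neg.add
      (((X.2.continuous_pres K).smul continuous_const).continuousOn.inner (c Y K F 1))).add
      (((X.2.continuous_temp K).smul continuous_const).continuousOn.inner (c Y K F 2)))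
  have i2 : ∀ (K : M.elems) (F : M.faces), IntegrableOn (f2 K F) F.1 (surf d) := fun K F =>
    Mesh.integrable_face F (continuousOn_const.mul
      (continuousOn_finsetSum _ fun j _ => (c X K F j).inner (c Y K F j)))
  have b1 : formB P X.1 Y.1 = bdrySum M f1 := by
    rw [formB, add_eq_right]
    have z : ∀ (K : M.elems) x, frob (totalStress P X.1 K x) (strain (Y.1.vel K 0) x)
        - X.1.pres K x * dvg (Y.1.vel K 1) x - X.1.temp K x * dvg (Y.1.vel K 2) x = 0 :=
      fun K x => by simp [v0, strain, dvg, g0, frob]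
    simp [volSum, z]
  have s1 : stab k X.1 Y.1 = bdrySum M f2 := rfl
  rw [steadyForm_apply, d0, b0, b1, s1, zero_add, sub_zero, bdrySum_eq_sum_faces _ i1,
    bdrySum_eq_sum_faces _ i2, ← Finset.sum_add_distrib]
  refine Finset.sum_congr rfl fun F _ => ?_
  rw [← integral_add (integrable_finsetSum _ fun K _ => i1 K F)
    (integrable_finsetSum _ fun K _ => i2 K F), faceResidual, ← integral_const_mul]
  refine integral_congr_ae (Filter.Eventually.of_forall fun x => ?_)
  have hk : ((k : ℝ) + 1) ^ 2 ≠ 0 := by positivity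
  have hF := (M.diam_face_pos hd F).ne'
  have m := fun f : M.elems → Pt d => adjCount_smul_faceMean F f
  have mu : ∀ (f : M.elems → Pt d) (y : Pt d), ∑ K : M.elems with F.1 ⊆ K.1, ⟪f K, y⟫
      = adjCount F * ⟪faceMean F f, y⟫ := fun f y => by
    rw [← sum_inner, ← m f, real_inner_smul_left]
  have mc : ∀ a : ℝ, ∑ K : M.elems with F.1 ⊆ K.1, a = adjCount F * a := fun a => by
    rw [Finset.sum_const, nsmul_eq_mul, adjCount]
  simp only [f1, f2, v0, Pi.zero_apply, zero_sub, inner_neg_right, neg_neg, Fin.sum_univ_three,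
    inner_sub_left, Finset.sum_add_distrib, Finset.sum_neg_distrib, Finset.sum_sub_distrib, mu, mc,
    ← Finset.mul_sum]
  simp only [faceFlux, Matrix.cons_val_zero, Matrix.cons_val_one, Matrix.cons_val_two,
    Matrix.head_cons, Matrix.tail_cons, inner_sub_left, inner_add_left,
    real_inner_smul_left]
  field_simp
  ring

/-- Multiplication of the face columns by a constant on each face. -/
def scaleHat (a : M.faces → ℝ) (X : HDGField M) : HDGField M :=
  ⟨0, fun F j x => a F • X.velHat F j x, 0, 0, 0⟩

theorem scaleHat_memSpace (a : M.faces → ℝ) {X : HDGField M} (hX : X.MemSpace k) :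
    (scaleHat a X).MemSpace k where
  vel K _ _ := (M.poly (k + 1) K.1).zero_mem
  velHat F j i := (M.facePoly (k + 1) F.1).smul_mem (a F) (hX.velHat F j i)
  velHat_boundary F hF := by
    ext j x
    simp [scaleHat, hX.velHat_boundary F hF]
  stress K _ _ := (M.poly k K.1).zero_mem
  pres K := (M.poly k K.1).zero_mem
  temp K := (M.poly k K.1).zero_mem

theorem scaleHat_mem_hatSpace (a : M.faces → ℝ) {X : HDGField M} (hX : X.MemSpace k) :
    (⟨scaleHat a X, scaleHat_memSpace a hX⟩ : space M k) ∈ hatSpace M k :=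
  ⟨rfl, rfl, rfl, rfl⟩

theorem faceResidual_scaleHat (X Y : HDGField M) (a : M.faces → ℝ) (F : M.faces) :
    faceResidual P X (scaleHat a Y) k F = a F * faceResidual P X Y k F := by
  rw [faceResidual, faceResidual, ← integral_const_mul]
  simp only [scaleHat, real_inner_smul_right, Finset.mul_sum]

theorem isEliminated_iff_residual (X : space M k) : IsEliminated P k X.1 ↔
    ∀ Y : HDGField M, Y.MemSpace k → ∑ F : M.faces, faceResidual P X.1 Y k F = 0 := by
  refine forall₂_congr fun Y hY => ?_
  have c := fun (F : M.faces) j => hY.continuousOn_velHat F j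
  have i1 : ∀ F : M.faces, IntegrableOn
      (fun x => ∑ j, ⟪X.1.velHat F j x, Y.velHat F j x⟫) F.1 (surf d) := fun F =>
    Mesh.integrable_face F (continuousOn_finsetSum _ fun j _ =>
      (X.2.continuousOn_velHat F j).inner (c F j))
  have i2 : ∀ F : M.faces, IntegrableOn
      (fun x => ∑ j, ⟪faceFlux P k X.1 F x j, Y.velHat F j x⟫) F.1 (surf d) := fun F =>
    Mesh.integrable_face F (continuousOn_finsetSum _ fun j _ =>
      (continuous_faceFlux P X F j).continuousOn.inner (c F j))
  rw [← sub_eq_zero, faceSum, faceSum, ← Finset.sum_sub_distrib]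
  simp only [← integral_sub (i1 _) (i2 _), faceResidual, inner_sub_left, Finset.sum_sub_distrib]

/-- The face columns solve their elimination problem exactly when the scheme holds for all pure face
test functions. -/
theorem isEliminated_iff (hd : 2 ≤ d) (X : space M k) : IsEliminated P k X.1 ↔
    ∀ Y ∈ hatSpace M k, steadyForm M k P X Y = 0 := by
  have hw : ∀ F : M.faces, adjCount F * (((k : ℝ) + 1) ^ 2 / Metric.diam F.1) ≠ 0 := fun F =>
    (mul_pos (adjCount_pos F) (div_pos (by positivity) (M.diam_face_pos hd F))).ne'
  rw [isEliminated_iff_residual]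
  constructor
  · intro h Y hY
    rw [steadyForm_hat P hd X hY]
    refine (Finset.sum_congr rfl fun F _ => ?_).trans (h _ (scaleHat_memSpace
      (fun F => adjCount F * (((k : ℝ) + 1) ^ 2 / Metric.diam F.1)) Y.2))
    rw [faceResidual_scaleHat]
  · intro h Y hY
    -- the weights are absorbed into the test function
    have := h _ (scaleHat_mem_hatSpace
      (fun F => (adjCount F * (((k : ℝ) + 1) ^ 2 / Metric.diam F.1))⁻¹) hY)
    rw [steadyForm_hat P hd X (scaleHat_mem_hatSpace _ hY)] at this
    rw [← this]
    refine Finset.sum_congr rfl fun F _ => ?_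
    rw [faceResidual_scaleHat, mul_inv_cancel_left₀ (hw F)]

/-- On pure face fields the scheme reduces to the stabilization, which is definite. -/
theorem eq_zero_of_steadyForm_hat (hd : 2 ≤ d) {H : space M k} (hH : H ∈ hatSpace M k)
    (h : steadyForm M k P H H = 0) : H = 0 := by
  rw [steadyForm_hat P hd H hH] at h
  obtain ⟨h1, h2, h3, h4⟩ := hH
  have hflux : ∀ F x j, faceFlux P k H.1 F x j = 0 := fun F x j => by
    have : ∀ K x, totalStress P H.1 K x = 0 := fun K x => by simp [totalStress, h2, h3, h4]
    fin_cases j <;> simp [faceFlux, faceMean, h1, h3, h4, this, act]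
  have hw : ∀ F : M.faces, 0 < adjCount F * (((k : ℝ) + 1) ^ 2 / Metric.diam F.1) := fun F =>
    mul_pos (adjCount_pos F) (div_pos (by positivity) (M.diam_face_pos hd F))
  have hnn : ∀ (F : M.faces) x, 0 ≤ ∑ j, ‖H.1.velHat F j x‖ ^ 2 := fun F x => by positivity
  have hres : ∀ F, faceResidual P H.1 H.1 k F
      = ∫ x in F.1, ∑ j, ‖H.1.velHat F j x‖ ^ 2 ∂(surf d) := fun F => by
    simp only [faceResidual, hflux, sub_zero, real_inner_self_eq_norm_sq]
  have hz : ∀ F : M.faces, H.1.velHat F = 0 := fun F => by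
    have h5 := (Finset.sum_eq_zero_iff_of_nonneg fun F _ => mul_nonneg (hw F).le
      (by rw [hres]; exact integral_nonneg (hnn F))).1 h F (Finset.mem_univ F)
    have h6 := (mul_eq_zero.1 h5).resolve_left (hw F).ne'
    rw [hres, integral_eq_zero_iff_of_nonneg (hnn F) (Mesh.integrable_face F
      (continuousOn_finsetSum _ fun j _ => (H.2.continuousOn_velHat F j).norm.pow 2))] at h6
    ext j x i
    refine congrFun (Mesh.eq_zero_of_mem_facePoly_of_ae (H.2.velHat F j i) ?_) x
    filter_upwards [h6] with y hy
    have h7 := (Finset.sum_eq_zero_iff_of_nonneg fun j _ => by positivity).1 hy j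
      (Finset.mem_univ j)
    have h8 : H.1.velHat F j y = 0 := by simpa using h7
    rw [h8]
    rfl
  exact Subtype.ext (HDGField.ext h1 (funext hz) h2 h3 h4)

/-! ### The space of eliminated fields -/

variable (M k) in
/-- The discrete fields whose face columns are determined by their volume components through the
elimination formula. -/
noncomputable def elimSpace : Submodule ℝ (space M k) where
  carrier := {X | ∀ Y ∈ hatSpace M k, steadyForm M k P X Y = 0}
  add_mem' hX hX' Y hY := by
    rw [map_add, LinearMap.add_apply, hX Y hY, hX' Y hY, add_zero]
  zero_mem' Y _ := by rw [map_zero, LinearMap.zero_apply]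
  smul_mem' c X hX Y hY := by
    rw [map_smul, LinearMap.smul_apply, hX Y hY, smul_zero]

theorem mem_elimSpace_iff (hd : 2 ≤ d) (X : space M k) :
    X ∈ elimSpace M k P ↔ IsEliminated P k X.1 := (isEliminated_iff P hd X).symm

/-- Every discrete field splits into an eliminated field and a pure face field. -/
theorem exists_elimSpace_sub_mem (hd : 2 ≤ d) (X : space M k) :
    ∃ Z ∈ elimSpace M k P, X - Z ∈ hatSpace M k := by
  obtain ⟨H, hH, -⟩ := existsUnique_of_definite
    ((steadyForm M k P).domRestrict₁₂ (hatSpace M k) (hatSpace M k))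
    (fun H hH => Subtype.ext (eq_zero_of_steadyForm_hat P hd H.2 hH))
    ((steadyForm M k P X).domRestrict (hatSpace M k))
  refine ⟨X - H.1, fun Y hY => ?_, by rw [sub_sub_cancel]; exact H.2⟩
  have : steadyForm M k P H.1 Y = steadyForm M k P X Y := hH ⟨Y, hY⟩
  rw [map_sub, LinearMap.sub_apply, this, sub_self]

theorem eq_zero_of_mem_elimSpace (hd : 2 ≤ d) {X : space M k} (hX : X ∈ elimSpace M k P)
    (h : X ∈ hatSpace M k) : X = 0 :=
  eq_zero_of_steadyForm_hat P hd h (hX X h)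

theorem massForm_hat (X : space M k) {Y : space M k} (hY : Y ∈ hatSpace M k) :
    massForm M k P X Y = 0 := by
  obtain ⟨h1, h2, h3, h4⟩ := hY
  simp [massForm_apply, innerH1, innerH2, volSum, h1, h2, h3, h4, frob]

end Elimination

/-! ### Linear evolution problems in finite dimensions -/

section Evolution

theorem exists_linear_ode_solution {E : Type*} [NormedAddCommGroup E] [NormedSpace ℝ E]
    [CompleteSpace E] {T : ℝ} (hT : 0 ≤ T) (L : E →L[ℝ] E) {f : ℝ → E}
    (hf : ContinuousOn f (Icc 0 T)) (y₀ : E) :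
    ∃ y : ℝ → E, y 0 = y₀ ∧
      ∀ t ∈ Icc 0 T, HasDerivWithinAt y (L (y t) + f t) (Icc 0 T) t := by
  let g : ℝ → E := fun t => f (projIcc 0 T hT t)
  have hg : Continuous g :=
    (continuousOn_iff_continuous_domRestrict.1 hf).comp continuous_projIcc
  have hgf : ∀ t ∈ Icc 0 T, g t = f t := fun t ht => by
    simp only [g, projIcc_of_mem hT ht]
  -- Duhamel's formula
  let h : ℝ → E := fun s => NormedSpace.exp ((-s) • L) (g s)
  have hexp : ∀ t : ℝ, HasDerivAt (fun s : ℝ => NormedSpace.exp (s • L))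
      (L * NormedSpace.exp (t • L)) t := fun t => hasDerivAt_exp_smul_const' L t
  have hh : Continuous h := by
    have h1 : Continuous fun s : ℝ => NormedSpace.exp (s • L) :=
      continuous_iff_continuousAt.2 fun t => (hexp t).continuousAt
    exact (h1.comp continuous_neg).clm_apply hg
  refine ⟨fun t => NormedSpace.exp (t • L) (y₀ + ∫ s in (0 : ℝ)..t, h s), ?_, fun t ht => ?_⟩
  · simp
  · have h2 : HasDerivAt (fun t => y₀ + ∫ s in (0 : ℝ)..t, h s) (h t) t :=
      (intervalIntegral.integral_hasDerivAt_right (hh.intervalIntegrable _ _)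
        (hh.stronglyMeasurableAtFilter _ _) hh.continuousAt).const_add y₀
    have h3 := (hexp t).clm_apply h2
    have h4 : NormedSpace.exp (t • L) (h t) = f t := by
      have h5 : NormedSpace.exp (t • L) * NormedSpace.exp ((-t) • L) = 1 := by
        let _ : NormedAlgebra ℚ (E →L[ℝ] E) := NormedAlgebra.restrictScalars ℚ ℝ _
        have hc : Commute (t • L) ((-t) • L) :=
          ((Commute.refl L).smul_left t).smul_right (-t)
        rw [← NormedSpace.exp_add_of_commute hc, ← add_smul, add_neg_cancel, zero_smul,
          NormedSpace.exp_zero]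
      rw [← hgf t ht]
      exact congrArg (fun A : E →L[ℝ] E => A (g t)) h5
    rw [h4] at h3
    exact h3.hasDerivWithinAt

/-- Grönwall's inequality with the rate `‖L‖ + 1`, which is positive also when `L = 0`. -/
theorem norm_le_of_linear_ode {E : Type*} [NormedAddCommGroup E] [NormedSpace ℝ E]
    {T : ℝ} (L : E →L[ℝ] E) {f y : ℝ → E}
    (hy : ∀ t ∈ Icc 0 T, HasDerivWithinAt y (L (y t) + f t) (Icc 0 T) t)
    {δ ε : ℝ} (hδ : ‖y 0‖ ≤ δ) (hε : 0 ≤ ε) (hf : ∀ t ∈ Icc 0 T, ‖f t‖ ≤ ε) :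
    ∀ t ∈ Icc 0 T, ‖y t‖ ≤ Real.exp ((‖L‖ + 1) * T) * (δ + ε) := by
  have hK : 0 < ‖L‖ + 1 := by positivity
  have hδ0 : 0 ≤ δ := (norm_nonneg _).trans hδ
  intro t ht
  have h1 := norm_le_gronwallBound_of_norm_deriv_right_le (f := y) (K := ‖L‖ + 1) (ε := ε)
    (fun s hs => (hy s hs).continuousWithinAt)
    (fun s hs => (hy s (Ico_subset_Icc_self hs)).mono_of_mem_nhdsWithin
      (Icc_mem_nhdsGE_of_mem hs)) hδ
    (fun s hs => by
      have h2 := L.le_opNorm (y s)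
      have h3 := hf s (Ico_subset_Icc_self hs)
      have h4 := norm_add_le (L (y s)) (f s)
      nlinarith [norm_nonneg (y s)]) t ht
  rw [gronwallBound_of_K_ne_0 hK.ne', sub_zero] at h1
  have h5 : Real.exp ((‖L‖ + 1) * t) ≤ Real.exp ((‖L‖ + 1) * T) :=
    Real.exp_le_exp.2 (mul_le_mul_of_nonneg_left ht.2 hK.le)
  have h6 : ε / (‖L‖ + 1) ≤ ε := div_le_self hε (by linarith [norm_nonneg L])
  have h7 : 1 ≤ Real.exp ((‖L‖ + 1) * t) :=
    Real.one_le_exp (mul_nonneg hK.le ht.1)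
  calc ‖y t‖ ≤ δ * Real.exp ((‖L‖ + 1) * t)
        + ε / (‖L‖ + 1) * (Real.exp ((‖L‖ + 1) * t) - 1) := h1
    _ ≤ δ * Real.exp ((‖L‖ + 1) * T) + ε * Real.exp ((‖L‖ + 1) * T) := by
        gcongr
        linarith
    _ = _ := by ring

variable {Z : Type*} [AddCommGroup Z] [Module ℝ Z] {T : ℝ}

/-- `x` is a `C¹` curve with derivative `x'` in a vector space without a chosen topology: this is
tested with linear functionals. -/
def IsC1Curve (T : ℝ) (x x' : ℝ → Z) : Prop :=
  ∀ φ : Z →ₗ[ℝ] ℝ, IsC1 T (fun t => φ (x t)) (fun t => φ (x' t))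

theorem IsC1.const_mul {f f' : ℝ → ℝ} (h : IsC1 T f f') (c : ℝ) :
    IsC1 T (fun t => c * f t) (fun t => c * f' t) :=
  ⟨continuousOn_const.mul h.1, fun t ht => (h.2 t ht).const_mul c⟩

theorem IsC1.sum {ι : Type*} (s : Finset ι) {f f' : ι → ℝ → ℝ} (h : ∀ i, IsC1 T (f i) (f' i)) :
    IsC1 T (fun t => ∑ i ∈ s, f i t) (fun t => ∑ i ∈ s, f' i t) :=
  ⟨continuousOn_finsetSum _ fun i _ => (h i).1,
    fun t ht => HasDerivWithinAt.fun_sum fun i _ => (h i).2 t ht⟩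

variable [Module.Finite ℝ Z]

theorem isC1Curve_iff (x x' : ℝ → Z) : IsC1Curve T x x' ↔
    ContinuousOn (fun t => (Module.finBasis ℝ Z).equivFun (x' t)) (Icc 0 T) ∧
    ∀ t ∈ Icc 0 T, HasDerivWithinAt (fun t => (Module.finBasis ℝ Z).equivFun (x t))
      ((Module.finBasis ℝ Z).equivFun (x' t)) (Icc 0 T) t := by
  set b := Module.finBasis ℝ Z
  constructor
  · intro h
    exact ⟨continuousOn_pi.2 fun i => (h (b.coord i)).1,
      fun t ht => hasDerivWithinAt_pi.2 fun i => (h (b.coord i)).2 t ht⟩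
  · rintro ⟨h1, h2⟩ φ
    have key : ∀ z, φ z = ∑ i, φ (b i) * b.equivFun z i := fun z => by
      have hz := congrArg φ (b.sum_equivFun z)
      rw [map_sum] at hz
      rw [← hz]
      exact Finset.sum_congr rfl fun i _ => by rw [map_smul, smul_eq_mul, mul_comm]
    rw [show (fun t => φ (x t)) = _ from funext fun t => key (x t),
      show (fun t => φ (x' t)) = _ from funext fun t => key (x' t)]
    exact IsC1.sum _ fun i => IsC1.const_mul
      ⟨continuousOn_pi.1 h1 i, fun t ht => hasDerivWithinAt_pi.1 (h2 t ht) i⟩ _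

variable (m a : Z →ₗ[ℝ] Z →ₗ[ℝ] ℝ) (hm : ∀ x, m x x = 0 → x = 0)

/-- A bilinear form without isotropic vectors, as an isomorphism onto the dual space. -/
noncomputable def dualEquiv : Z ≃ₗ[ℝ] (Z →ₗ[ℝ] ℝ) :=
  LinearEquiv.ofBijective m ((Function.bijective_iff_existsUnique _).2 fun φ => by
    obtain ⟨x, hx, hu⟩ := existsUnique_of_definite m hm φ
    exact ⟨x, LinearMap.ext hx, fun y hy => hu y fun z => by rw [hy]⟩)

/-- The generator of the evolution problem in coordinates. -/
noncomputable def generator :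
    (Fin (Module.finrank ℝ Z) → ℝ) →L[ℝ] (Fin (Module.finrank ℝ Z) → ℝ) :=
  LinearMap.toContinuousLinearMap
    (-((Module.finBasis ℝ Z).equivFun.toLinearMap ∘ₗ (dualEquiv m hm).symm.toLinearMap ∘ₗ a ∘ₗ
      (Module.finBasis ℝ Z).equivFun.symm.toLinearMap))

/-- Coordinates of the representer of a functional. -/
noncomputable def forcing (φ : Z →ₗ[ℝ] ℝ) : Fin (Module.finrank ℝ Z) → ℝ :=
  (Module.finBasis ℝ Z).equivFun ((dualEquiv m hm).symm φ)

/-- The variational equation is the linear ODE `x' = L x + f` in coordinates. -/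
theorem variational_iff (x x' : Z) (φ : Z →ₗ[ℝ] ℝ) :
    (∀ y, m x' y + a x y = φ y) ↔ (Module.finBasis ℝ Z).equivFun x'
      = generator m a hm ((Module.finBasis ℝ Z).equivFun x) + forcing m hm φ := by
  have h1 : (∀ y, m x' y + a x y = φ y) ↔ dualEquiv m hm x' = -a x + φ := by
    rw [LinearMap.ext_iff]
    refine forall_congr' fun y => ?_
    change _ ↔ m x' y = -a x y + φ y
    constructor <;> intro h <;> linarith
  rw [h1, ← LinearEquiv.eq_symm_apply, ← (Module.finBasis ℝ Z).equivFun.injective.eq_iff]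
  simp [generator, forcing]

theorem forcing_eq_sum (φ : Z →ₗ[ℝ] ℝ) : forcing m hm φ
    = ∑ i, φ (Module.finBasis ℝ Z i) • forcing m hm ((Module.finBasis ℝ Z).coord i) := by
  conv_lhs => rw [← (Module.finBasis ℝ Z).sum_dual_apply_smul_coord φ]
  simp only [forcing, map_sum, map_smul]

theorem exists_evolution (hT : 0 ≤ T) {φ : ℝ → Z →ₗ[ℝ] ℝ}
    (hφ : ∀ y, ContinuousOn (fun t => φ t y) (Icc 0 T)) (z₀ : Z)
    (hm : ∀ x, m x x = 0 → x = 0) :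
    ∃ x x' : ℝ → Z, IsC1Curve T x x' ∧ x 0 = z₀ ∧
      ∀ t ∈ Icc 0 T, ∀ y, m (x' t) y + a (x t) y = φ t y := by
  set e := (Module.finBasis ℝ Z).equivFun with he
  have hf : ContinuousOn (fun t => forcing m hm (φ t)) (Icc 0 T) := by
    simp only [forcing_eq_sum m hm (φ _)]
    exact continuousOn_finsetSum _ fun i _ => (hφ _).smul continuousOn_const
  obtain ⟨y, hy0, hy⟩ := exists_linear_ode_solution hT (generator m a hm) hf (e z₀)
  let x' : ℝ → Z := fun t => e.symm (generator m a hm (y t) + forcing m hm (φ t))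
  have hyc : ContinuousOn y (Icc 0 T) := fun t ht => (hy t ht).continuousWithinAt
  refine ⟨fun t => e.symm (y t), x', ?_, by simp only [hy0, e.symm_apply_apply], fun t ht => ?_⟩
  · rw [isC1Curve_iff]
    simp only [← he, x', e.apply_symm_apply]
    exact ⟨((generator m a hm).continuous.comp_continuousOn hyc).add hf, hy⟩
  · rw [variational_iff m a hm]
    simp only [← he, x', e.apply_symm_apply]

/-- Solutions grow at most exponentially, with a constant depending only on the two forms, on `T`
and on the weights `β`, `γ` in which data are measured. -/
theorem exists_evolution_bound (hm : ∀ x, m x x = 0 → x = 0) (T : ℝ) (β : Z → ℝ)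
    (γ : (Z →ₗ[ℝ] ℝ) → ℝ) :
    ∃ C : ℝ, 0 ≤ C ∧ ∀ (φ : ℝ → Z →ₗ[ℝ] ℝ) (x x' : ℝ → Z) (μ S : ℝ), 0 ≤ μ → 0 ≤ S →
      IsC1Curve T x x' → (∀ t ∈ Icc 0 T, ∀ y, m (x' t) y + a (x t) y = φ t y) →
      (∀ t ∈ Icc 0 T, ∀ y, |φ t y| ≤ β y * μ) → (∀ ψ : Z →ₗ[ℝ] ℝ, |ψ (x 0)| ≤ γ ψ * S) →
      ∀ t ∈ Icc 0 T, ‖(Module.finBasis ℝ Z).equivFun (x t)‖ ≤ C * (S + μ) := by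
  set b := Module.finBasis ℝ Z with hb
  let C₁ : ℝ := ∑ i, |γ (b.coord i)|
  let C₂ : ℝ := ∑ i, |β (b i)| * ‖forcing m hm (b.coord i)‖
  have hC₁ : 0 ≤ C₁ := by positivity
  have hC₂ : 0 ≤ C₂ := by positivity
  let e := Real.exp ((‖generator m a hm‖ + 1) * T)
  have he : 0 < e := Real.exp_pos _
  refine ⟨e * (C₁ + C₂), by positivity, fun φ x x' μ S hμ hS hx heq hφ h0 t ht => ?_⟩
  rw [isC1Curve_iff] at hx
  have h1 := norm_le_of_linear_ode (generator m a hm) (f := fun t => forcing m hm (φ t))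
    (y := fun t => b.equivFun (x t)) (δ := C₁ * S) (ε := C₂ * μ)
    (fun s hs => by
      rw [← (variational_iff m a hm (x s) (x' s) (φ s)).1 (heq s hs)]
      exact hx.2 s hs)
    ((pi_norm_le_iff_of_nonneg (by positivity)).2 fun i => by
      refine (h0 (b.coord i)).trans (mul_le_mul_of_nonneg_right ?_ hS)
      exact (le_abs_self _).trans
        (Finset.single_le_sum (f := fun i => |γ (b.coord i)|) (fun _ _ => abs_nonneg _)
          (Finset.mem_univ i)))
    (by positivity)
    (fun s hs => by
      rw [forcing_eq_sum, Finset.sum_mul]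
      refine (norm_sum_le _ _).trans (Finset.sum_le_sum fun i _ => ?_)
      rw [norm_smul, Real.norm_eq_abs, ← hb]
      have h2 : |φ s (b i)| ≤ |β (b i)| * μ :=
        (hφ s hs _).trans (mul_le_mul_of_nonneg_right (le_abs_self _) hμ)
      calc |φ s (b i)| * ‖forcing m hm (b.coord i)‖
          ≤ |β (b i)| * μ * ‖forcing m hm (b.coord i)‖ := by gcongr
        _ = _ := by ring) t ht
  refine h1.trans ?_
  change e * _ ≤ _
  rw [mul_assoc]
  refine mul_le_mul_of_nonneg_left ?_ he.le
  nlinarith [mul_nonneg hC₁ hμ, mul_nonneg hC₂ hS]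

/-- The difference of two solutions has zero data. -/
theorem evolution_unique (hm : ∀ x, m x x = 0 → x = 0) {φ : ℝ → Z →ₗ[ℝ] ℝ} {x x' y y' : ℝ → Z}
    (hx : IsC1Curve T x x') (hy : IsC1Curve T y y')
    (hxe : ∀ t ∈ Icc 0 T, ∀ z, m (x' t) z + a (x t) z = φ t z)
    (hye : ∀ t ∈ Icc 0 T, ∀ z, m (y' t) z + a (y t) z = φ t z) (h0 : x 0 = y 0) :
    ∀ t ∈ Icc 0 T, x t = y t := by
  obtain ⟨C, -, hC⟩ := exists_evolution_bound m a hm T 0 0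
  intro t ht
  have h1 := hC (fun _ => 0) (fun t => x t - y t) (fun t => x' t - y' t) 0 0 le_rfl le_rfl
    (fun ψ => by
      simp only [map_sub]
      exact ⟨(hx ψ).1.sub (hy ψ).1, fun t ht => ((hx ψ).2 t ht).sub ((hy ψ).2 t ht)⟩)
    (fun t ht z => by
      simp only [map_sub, LinearMap.sub_apply, LinearMap.zero_apply]
      linarith [hxe t ht z, hye t ht z])
    (by simp) (by simp [h0]) t ht
  rw [add_zero, mul_zero, norm_le_zero_iff, LinearEquiv.map_eq_zero_iff] at h1
  exact sub_eq_zero.1 h1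

theorem exists_form_bound (m : Z →ₗ[ℝ] Z →ₗ[ℝ] ℝ) :
    ∃ C : ℝ, 0 ≤ C ∧ ∀ z, m z z ≤ C * ‖(Module.finBasis ℝ Z).equivFun z‖ ^ 2 := by
  set b := Module.finBasis ℝ Z
  refine ⟨∑ i, ∑ j, |m (b i) (b j)|, by positivity, fun z => ?_⟩
  have h1 : m z z = ∑ i, ∑ j, b.equivFun z i * b.equivFun z j * m (b i) (b j) := by
    conv_lhs => rw [← b.sum_equivFun z]
    simp only [map_sum, map_smul, LinearMap.sum_apply, LinearMap.smul_apply, smul_eq_mul]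
    rw [Finset.sum_comm]
    refine Finset.sum_congr rfl fun i _ => ?_
    rw [Finset.mul_sum]
    refine Finset.sum_congr rfl fun j _ => ?_
    ring
  rw [h1, Finset.sum_mul]
  refine Finset.sum_le_sum fun i _ => ?_
  rw [Finset.sum_mul]
  refine Finset.sum_le_sum fun j _ => ?_
  refine (le_abs_self _).trans ?_
  rw [abs_mul, abs_mul, mul_comm, sq]
  have h2 := norm_le_pi_norm (b.equivFun z) i
  have h3 := norm_le_pi_norm (b.equivFun z) j
  rw [Real.norm_eq_abs] at h2 h3
  gcongr

end Evolution

/-! ### Time regularity from point values -/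

section PointValues

variable {Z : Type*} [AddCommGroup Z] [Module ℝ Z] [Module.Finite ℝ Z] {T : ℝ}

/-- In finite dimensions a separating family of functionals spans the dual space. -/
theorem exists_eq_sum_of_separating {ι : Type*} {φ : ι → Z →ₗ[ℝ] ℝ}
    (hφ : ∀ z, (∀ i, φ i z = 0) → z = 0) (ψ : Z →ₗ[ℝ] ℝ) :
    ∃ c : ι →₀ ℝ, ∀ z, ψ z = ∑ i ∈ c.support, c i * φ i z := by
  let W : Submodule ℝ (Module.Dual ℝ Z) := Submodule.span ℝ (range φ)
  have h1 : W.dualCoannihilator = ⊥ := by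
    rw [eq_bot_iff]
    intro z hz
    rw [Submodule.mem_dualCoannihilator] at hz
    exact hφ z fun i => hz _ (Submodule.subset_span (mem_range_self i))
  have h2 : W = ⊤ := by
    rw [← Subspace.dualCoannihilator_dualAnnihilator_eq (W := W), h1,
      Submodule.dualAnnihilator_bot]
  have h3 : ψ ∈ W := h2 ▸ Submodule.mem_top
  obtain ⟨c, hc⟩ := Finsupp.mem_span_range_iff_exists_finsupp.1 h3
  refine ⟨c, fun z => ?_⟩
  rw [← hc, Finsupp.sum, LinearMap.sum_apply]
  rfl

/-- A curve that is `C¹` under a separating family of functionals is `C¹`. -/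
theorem exists_isC1Curve {ι : Type*} {φ : ι → Z →ₗ[ℝ] ℝ} (hφ : ∀ z, (∀ i, φ i z = 0) → z = 0)
    (hT : 0 < T) {x : ℝ → Z} {f' : ι → ℝ → ℝ} (h : ∀ i, IsC1 T (fun t => φ i (x t)) (f' i)) :
    ∃ x' : ℝ → Z, IsC1Curve T x x' ∧ ∀ i, ∀ t ∈ Icc 0 T, φ i (x' t) = f' i t := by
  set b := Module.finBasis ℝ Z with hb
  choose c hc using fun i => exists_eq_sum_of_separating hφ (b.coord i)
  let g : Fin (Module.finrank ℝ Z) → ℝ → ℝ := fun i t => ∑ l ∈ (c i).support, c i l * f' l t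
  have hg : ∀ i, IsC1 T (fun t => b.equivFun (x t) i) (g i) := fun i => by
    have h1 := IsC1.sum (c i).support fun l => (h l).const_mul (c i l)
    rwa [show (fun t => ∑ l ∈ (c i).support, c i l * φ l (x t)) = fun t => b.equivFun (x t) i from
      funext fun t => (hc i (x t)).symm] at h1
  have hcurve : IsC1Curve T x fun t => b.equivFun.symm fun i => g i t := by
    rw [isC1Curve_iff]
    simp only [← hb, LinearEquiv.apply_symm_apply]
    exact ⟨continuousOn_pi.2 fun i => (hg i).1,
      fun t ht => hasDerivWithinAt_pi.2 fun i => (hg i).2 t ht⟩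
  exact ⟨_, hcurve, fun i t ht =>
    (uniqueDiffOn_Icc hT t ht).eq_deriv _ ((hcurve (φ i)).2 t ht) ((h i).2 t ht)⟩

end PointValues

/-! ### Volume components of a field -/

section VolumeValues

open HDGField

variable {d : ℕ} {Ω : Set (Pt d)} {M : Mesh Ω} {k : ℕ} {T : ℝ}

/-- The point values of the volume components of a field. -/
inductive VolIndex (M : Mesh Ω)
  | vel (K : M.elems) (j : Fin 3) (x : Pt d) (i : Fin d)
  | stress (K : M.elems) (x : Pt d) (i j : Fin d)
  | pres (K : M.elems) (x : Pt d)
  | temp (K : M.elems) (x : Pt d)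

/-- Evaluation of a volume component at a point. -/
def volEval : VolIndex M → HDGField M →ₗ[ℝ] ℝ
  | .vel K j x i => ⟨⟨fun X => X.vel K j x i, fun _ _ => rfl⟩, fun _ _ => rfl⟩
  | .stress K x i j => ⟨⟨fun X => (X.stress K x).1 i j, fun _ _ => rfl⟩, fun _ _ => rfl⟩
  | .pres K x => ⟨⟨fun X => X.pres K x, fun _ _ => rfl⟩, fun _ _ => rfl⟩
  | .temp K x => ⟨⟨fun X => X.temp K x, fun _ _ => rfl⟩, fun _ _ => rfl⟩

theorem isC1Volume_iff {X X' : ℝ → HDGField M} : IsC1Volume T X X' ↔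
    ∀ v, IsC1 T (fun t => volEval v (X t)) (fun t => volEval v (X' t)) := by
  constructor
  · rintro ⟨h1, h2, h3, h4⟩ (⟨K, j, x, i⟩ | ⟨K, x, i, j⟩ | ⟨K, x⟩ | ⟨K, x⟩)
    · exact h1 K j x i
    · exact h2 K x i j
    · exact h3 K x
    · exact h4 K x
  · intro h
    exact ⟨fun K j x i => h (.vel K j x i), fun K x i j => h (.stress K x i j),
      fun K x => h (.pres K x), fun K x => h (.temp K x)⟩

/-- Two fields have the same volume components. -/
def VolEq (X Y : HDGField M) : Prop :=
  X.vel = Y.vel ∧ X.stress = Y.stress ∧ X.pres = Y.pres ∧ X.temp = Y.temp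

theorem volEq_of_volEval {X Y : HDGField M} (h : ∀ v, volEval v X = volEval v Y) : VolEq X Y := by
  refine ⟨?_, ?_, ?_, ?_⟩
  · ext K j x i
    exact h (.vel K j x i)
  · ext K x i j
    exact h (.stress K x i j)
  · ext K x
    exact h (.pres K x)
  · ext K x
    exact h (.temp K x)

theorem volEq_iff_sub_mem {X Y : space M k} : VolEq X.1 Y.1 ↔ X - Y ∈ hatSpace M k := by
  have e1 : (X - Y).1.vel = X.1.vel - Y.1.vel := rfl
  have e2 : (X - Y).1.stress = X.1.stress - Y.1.stress := rfl
  have e3 : (X - Y).1.pres = X.1.pres - Y.1.pres := rfl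
  have e4 : (X - Y).1.temp = X.1.temp - Y.1.temp := rfl
  change _ ↔ (X - Y).1.vel = 0 ∧ (X - Y).1.stress = 0 ∧ (X - Y).1.pres = 0 ∧ (X - Y).1.temp = 0
  rw [e1, e2, e3, e4, sub_eq_zero, sub_eq_zero, sub_eq_zero, sub_eq_zero]
  rfl

variable (P : Params d)

theorem elimSpace_eq_of_volEq (hd : 2 ≤ d) {X Y : elimSpace M k P} (h : VolEq X.1.1 Y.1.1) :
    X = Y :=
  sub_eq_zero.1 (Subtype.ext (eq_zero_of_mem_elimSpace P hd (X - Y).2 (volEq_iff_sub_mem.1 h)))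

/-- Volume point values separate eliminated fields. -/
theorem elimSpace_separating (hd : 2 ≤ d) (X : elimSpace M k P)
    (h : ∀ v : VolIndex M, (volEval v ∘ₗ (space M k).subtype ∘ₗ (elimSpace M k P).subtype) X = 0) :
    X = 0 :=
  elimSpace_eq_of_volEq P hd (volEq_of_volEval fun v => (h v).trans (map_zero _).symm)

/-- In the scheme, only the volume components of the time derivative matter. -/
theorem schemeLHS_congr {X X' X'' Y : HDGField M} (h : VolEq X' X'') :
    schemeLHS P k X X' Y = schemeLHS P k X X'' Y := by
  obtain ⟨h1, h2, h3, h4⟩ := h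
  simp only [schemeLHS, innerH1, innerH2, h1, h2, h3, h4]

/-- The time derivative does not enter when testing with a pure face field. -/
theorem schemeLHS_zero_deriv (X : HDGField M) (X' : HDGField M) {Y : HDGField M}
    (hY : VolEq Y 0) : schemeLHS P k X X' Y = schemeLHS P k X 0 Y := by
  obtain ⟨h1, h2, h3, h4⟩ := hY
  have e1 : ∀ W : HDGField M, innerH1 P W Y = 0 := fun W => by simp [innerH1, volSum, h1]
  have e2 : ∀ W : HDGField M, innerH2 P W Y = 0 := fun W => by
    simp [innerH2, volSum, h2, h3, h4, frob]
  simp only [schemeLHS, e1, e2]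

/-- Against an eliminated trial field, test functions with the same volume components are
equivalent. -/
theorem schemeLHS_congr_test {X X' Y Y' : space M k} (hX : X ∈ elimSpace M k P)
    (h : VolEq Y.1 Y'.1) : schemeLHS P k X.1 X'.1 Y.1 = schemeLHS P k X.1 X'.1 Y'.1 := by
  have h1 := volEq_iff_sub_mem.1 h
  have h2 := hX _ h1
  have h3 := massForm_hat P X' h1
  rw [map_sub] at h2 h3
  rw [schemeLHS_eq, schemeLHS_eq]
  linarith

/-! ### The right-hand side -/

theorem schemeRHS_congr {D : Data Ω T} {t : ℝ} {Y Y' : HDGField M} (h : VolEq Y Y') :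
    schemeRHS D t Y = schemeRHS D t Y' := by
  obtain ⟨h1, h2, h3, h4⟩ := h
  simp only [schemeRHS, h1, h4]

theorem integrable_schemeRHS (hΩ : IsOpen Ω) (D : Data Ω T) (t : ℝ) (Y : space M k) (K : M.elems) :
    IntegrableOn (fun x => (∑ j, ⟪D.F t j x, Y.1.vel K j x⟫) + D.g t x * Y.1.temp K x)
      (K.1 ∩ Ω) := by
  refine Integrable.add (integrable_finsetSum _ fun j _ => ?_) ?_
  · obtain ⟨L, hL⟩ := exists_pairing hΩ K (Y.2.continuous_vel K j)
    exact (hL _).1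
  · obtain ⟨L, hL⟩ := exists_pairing_real hΩ K (Y.2.continuous_temp K)
    exact (hL _).1

/-- The right-hand side of the scheme, as a functional on the discrete space. -/
noncomputable def load (hΩ : IsOpen Ω) (D : Data Ω T) (t : ℝ) : space M k →ₗ[ℝ] ℝ where
  toFun Y := schemeRHS D t Y.1
  map_add' Y Y' := by
    simp only [schemeRHS, volSum, ← Finset.sum_add_distrib]
    refine Finset.sum_congr rfl fun K _ => ?_
    rw [← integral_add (integrable_schemeRHS hΩ D t Y K) (integrable_schemeRHS hΩ D t Y' K)]
    refine integral_congr_ae (Filter.Eventually.of_forall fun x => ?_)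
    simp [inner_add_right, Finset.sum_add_distrib]
    ring
  map_smul' c Y := by
    simp only [schemeRHS, volSum, RingHom.id_apply, smul_eq_mul, Finset.mul_sum]
    refine Finset.sum_congr rfl fun K _ => ?_
    rw [← integral_const_mul]
    refine integral_congr_ae (Filter.Eventually.of_forall fun x => ?_)
    simp [real_inner_smul_right, ← Finset.mul_sum]
    ring

theorem exists_schemeRHS_eq (hΩ : IsOpen Ω) (Y : space M k) :
    ∃ (L : Fin 3 → Lp (Pt d) 2 (volume.restrict Ω) →L[ℝ] ℝ)
      (L' : Lp ℝ 2 (volume.restrict Ω) →L[ℝ] ℝ), ∀ (D : Data Ω T) (t : ℝ),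
      schemeRHS D t Y.1 = (∑ j, L j (D.F t j)) + L' (D.g t) := by
  choose L hL using fun (K : M.elems) (j : Fin 3) => exists_pairing hΩ K (Y.2.continuous_vel K j)
  choose L' hL' using fun K : M.elems => exists_pairing_real hΩ K (Y.2.continuous_temp K)
  refine ⟨fun j => ∑ K, L K j, ∑ K, L' K, fun D t => ?_⟩
  simp only [sum_apply]
  rw [Finset.sum_comm, ← Finset.sum_add_distrib, schemeRHS, volSum]
  refine Finset.sum_congr rfl fun K _ => ?_
  have i1 : ∀ j ∈ Finset.univ, IntegrableOn (fun x => ⟪D.F t j x, Y.1.vel K j x⟫) (K.1 ∩ Ω) :=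
    fun j _ => (hL K j _).1
  rw [integral_add (integrable_finsetSum _ i1) (hL' K _).1, integral_finsetSum _ i1, (hL' K _).2]
  simp only [(hL K _ _).2]

theorem continuousOn_schemeRHS (hΩ : IsOpen Ω) (D : Data Ω T) (Y : space M k) :
    ContinuousOn (fun t => schemeRHS D t Y.1) (Icc 0 T) := by
  obtain ⟨L, L', h⟩ := exists_schemeRHS_eq (T := T) hΩ Y
  simp only [h]
  exact (continuousOn_finsetSum _ fun j _ => (L j).continuous.comp_continuousOn
    (continuousOn_pi.1 D.continuousOn_F j)).add (L'.continuous.comp_continuousOn D.continuousOn_g)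

theorem exists_schemeRHS_bound (hΩ : IsOpen Ω) (T : ℝ) (Y : space M k) :
    ∃ C : ℝ, ∀ (D : Data Ω T) (t μ : ℝ), (∀ j, ‖D.F t j‖ ≤ μ) → ‖D.g t‖ ≤ μ →
      |schemeRHS D t Y.1| ≤ C * μ := by
  obtain ⟨L, L', h⟩ := exists_schemeRHS_eq (T := T) hΩ Y
  refine ⟨(∑ j, ‖L j‖) + ‖L'‖, fun D t μ hF hg => ?_⟩
  rw [h, add_mul, Finset.sum_mul]
  refine (abs_add_le _ _).trans (add_le_add ((Finset.abs_sum_le_sum_abs _ _).trans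
    (Finset.sum_le_sum fun j _ => ?_)) ?_)
  · exact ((L j).le_opNorm _).trans (mul_le_mul_of_nonneg_left (hF j) (norm_nonneg _))
  · exact (L'.le_opNorm _).trans (mul_le_mul_of_nonneg_left hg (norm_nonneg _))

/-! ### Initial values -/

theorem isVolumeInit_congr {D : Data Ω T} {X Y : HDGField M} (h : VolEq X Y)
    (hX : IsVolumeInit k D X) : IsVolumeInit k D Y := by
  obtain ⟨h1, h2, h3, h4⟩ := h
  exact ⟨h1 ▸ hX.vel, h2 ▸ hX.stress, h3 ▸ hX.pres, h4 ▸ hX.temp⟩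

theorem isVolumeInit_unique (hΩ : IsOpen Ω) {D : Data Ω T} {X Y : HDGField M}
    (hX : IsVolumeInit k D X) (hY : IsVolumeInit k D Y) : VolEq X Y := by
  refine volEq_of_volEval ?_
  rintro (⟨K, j, x, i⟩ | ⟨K, x, i, j⟩ | ⟨K, x⟩ | ⟨K, x⟩)
  · exact congrFun ((existsUnique_isL2Proj hΩ K _ (hasMoments_coord hΩ K _ i _)).unique
      (hX.vel K j i) (hY.vel K j i)) x
  · exact congrFun ((existsUnique_isL2Proj hΩ K _ (hasMoments_real hΩ K _ _)).unique
      (hX.stress K i j) (hY.stress K i j)) x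
  · exact congrFun ((existsUnique_isL2Proj hΩ K _ (hasMoments_real hΩ K _ _)).unique
      (hX.pres K) (hY.pres K)) x
  · exact congrFun ((existsUnique_isL2Proj hΩ K _ (hasMoments_real hΩ K _ _)).unique
      (hX.temp K) (hY.temp K)) x

variable (M k) in
theorem exists_isVolumeInit (hΩ : IsOpen Ω) (D : Data Ω T) :
    ∃ X : space M k, IsVolumeInit k D X.1 := by
  choose u hu using fun (K : M.elems) (j : Fin 3) (i : Fin d) =>
    (existsUnique_isL2Proj hΩ K (k + 1) (hasMoments_coord hΩ K (k + 1) i (D.vel0 j))).exists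
  have hs := fun (K : M.elems) (i j : Fin d) =>
    existsUnique_isL2Proj hΩ K k (hasMoments_real hΩ K k (D.stress0 i j))
  choose s hs' using fun K i j => (hs K i j).exists
  choose p hp using fun K : M.elems =>
    (existsUnique_isL2Proj hΩ K k (hasMoments_real hΩ K k D.pres0)).exists
  choose θ hθ using fun K : M.elems =>
    (existsUnique_isL2Proj hΩ K k (hasMoments_real hΩ K k D.temp0)).exists
  have hsymm : ∀ K i j, s K i j = s K j i := fun K i j =>
    (hs K i j).unique (hs' K i j) (D.stress0_symm i j ▸ hs' K j i)
  let X : HDGField M :=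
    { vel := fun K j x => WithLp.toLp 2 fun i => u K j i x
      velHat := 0
      stress := fun K x => ⟨Matrix.of fun i j => s K i j x, by
        ext i j
        exact congrFun (hsymm K j i) x⟩
      pres := p
      temp := θ }
  have hX : X.MemSpace k :=
    { vel := fun K j i => (hu K j i).1
      velHat := fun F _ _ => (M.facePoly (k + 1) F.1).zero_mem
      velHat_boundary := fun _ _ => rfl
      stress := fun K i j => (hs' K i j).1
      pres := fun K => (hp K).1
      temp := fun K => (hθ K).1 }
  exact ⟨⟨X, hX⟩, fun K j i => hu K j i, fun K i j => hs' K i j, hp, hθ⟩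

/-- The sum of the squared `L²` norms of the initial data. -/
noncomputable def initSize (D : Data Ω T) : ℝ :=
  (∑ j, ‖D.vel0 j‖ ^ 2) + (∑ i, ∑ j, ‖D.stress0 i j‖ ^ 2) + ‖D.pres0‖ ^ 2 + ‖D.temp0‖ ^ 2

/-- Point values of the projected initial data are controlled by the norms of the data. -/
theorem exists_volEval_bound (hΩ : IsOpen Ω) (T : ℝ) (k : ℕ) (v : VolIndex M) :
    ∃ C : ℝ, 0 ≤ C ∧ ∀ (D : Data Ω T) (X : HDGField M), IsVolumeInit k D X →
      |volEval v X| ≤ C * √(initSize D) := by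
  have n1 : ∀ D : Data Ω T, 0 ≤ ∑ j, ‖D.vel0 j‖ ^ 2 := fun D => by positivity
  have n2 : ∀ D : Data Ω T, 0 ≤ ∑ i, ∑ j, ‖D.stress0 i j‖ ^ 2 := fun D => by positivity
  rcases v with (⟨K, j, x, i⟩ | ⟨K, x, i, j⟩ | ⟨K, x⟩ | ⟨K, x⟩)
  · obtain ⟨C, hC, h⟩ := exists_abs_le_of_isL2Proj_coord hΩ K (k + 1) i x
    refine ⟨C, hC, fun D X hX => (h _ _ (hX.vel K j i)).trans ?_⟩
    refine mul_le_mul_of_nonneg_left (Real.le_sqrt_of_sq_le ?_) hC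
    have := Finset.single_le_sum (f := fun j => ‖D.vel0 j‖ ^ 2) (fun _ _ => by positivity)
      (Finset.mem_univ j)
    simp only [initSize]
    linarith [n2 D, sq_nonneg ‖D.pres0‖, sq_nonneg ‖D.temp0‖]
  · obtain ⟨C, hC, h⟩ := exists_abs_le_of_isL2Proj_real hΩ K k x
    refine ⟨C, hC, fun D X hX => (h _ _ (hX.stress K i j)).trans ?_⟩
    refine mul_le_mul_of_nonneg_left (Real.le_sqrt_of_sq_le ?_) hC
    have h1 := Finset.single_le_sum (f := fun j => ‖D.stress0 i j‖ ^ 2) (fun _ _ => by positivity)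
      (Finset.mem_univ j)
    have h2 := Finset.single_le_sum (f := fun i => ∑ j, ‖D.stress0 i j‖ ^ 2)
      (fun _ _ => by positivity) (Finset.mem_univ i)
    simp only [initSize]
    linarith [n1 D, sq_nonneg ‖D.pres0‖, sq_nonneg ‖D.temp0‖]
  · obtain ⟨C, hC, h⟩ := exists_abs_le_of_isL2Proj_real hΩ K k x
    refine ⟨C, hC, fun D X hX => (h _ _ (hX.pres K)).trans ?_⟩
    refine mul_le_mul_of_nonneg_left (Real.le_sqrt_of_sq_le ?_) hC
    simp only [initSize]
    linarith [n1 D, n2 D, sq_nonneg ‖D.temp0‖]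
  · obtain ⟨C, hC, h⟩ := exists_abs_le_of_isL2Proj_real hΩ K k x
    refine ⟨C, hC, fun D X hX => (h _ _ (hX.temp K)).trans ?_⟩
    refine mul_le_mul_of_nonneg_left (Real.le_sqrt_of_sq_le ?_) hC
    simp only [initSize]
    linarith [n1 D, n2 D, sq_nonneg ‖D.pres0‖]

end VolumeValues

/-! ### The scheme as an evolution equation -/

section Scheme

open HDGField

variable {d : ℕ} {Ω : Set (Pt d)} {M : Mesh Ω} {k : ℕ} {T : ℝ} (P : Params d)

/-- The mass form on the eliminated fields. -/
noncomputable def elimMass (M : Mesh Ω) (k : ℕ) (P : Params d) :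
    elimSpace M k P →ₗ[ℝ] elimSpace M k P →ₗ[ℝ] ℝ :=
  (massForm M k P).domRestrict₁₂ _ _

/-- The steady form on the eliminated fields. -/
noncomputable def elimSteady (M : Mesh Ω) (k : ℕ) (P : Params d) :
    elimSpace M k P →ₗ[ℝ] elimSpace M k P →ₗ[ℝ] ℝ :=
  (steadyForm M k P).domRestrict₁₂ _ _

theorem elimMass_definite (hd : 2 ≤ d) (hΩ : IsOpen Ω) (X : elimSpace M k P)
    (h : elimMass M k P X X = 0) : X = 0 :=
  Subtype.ext (eq_zero_of_mem_elimSpace P hd X.2 (mem_hatSpace_of_massForm P hΩ h))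

/-- `x`, with derivative `x'`, is a `C¹` curve of eliminated fields solving the scheme tested with
eliminated fields, and starting from the projected initial data. -/
structure IsEvolution (P : Params d) (k : ℕ) (hΩ : IsOpen Ω) (D : Data Ω T)
    (x x' : ℝ → elimSpace M k P) : Prop where
  isC1 : IsC1Curve T x x'
  eq : ∀ t ∈ Icc 0 T, ∀ y, elimMass M k P (x' t) y + elimSteady M k P (x t) y
    = (load hΩ D t).domRestrict (elimSpace M k P) y
  init : IsVolumeInit k D (x 0).1.1

/-- Testing the scheme with pure face fields yields the elimination formula. -/
theorem IsSolution.isReducedSolution (hd : 2 ≤ d) {D : Data Ω T} {X : ℝ → HDGField M}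
    (hX : IsSolution P k D X) : IsReducedSolution P k D X := by
  obtain ⟨hmem, ⟨X', hvol, -, heq⟩, hinit⟩ := hX
  refine ⟨fun t ht => ⟨hmem t ht, ?_⟩, ⟨X', hvol, fun t ht Y hY _ => heq t ht Y hY⟩, hinit⟩
  refine (isEliminated_iff P hd ⟨X t, hmem t ht⟩).2 fun Y hY => ?_
  have hY0 : VolEq Y.1 0 := hY
  have h1 := heq t ht Y.1 Y.2
  rw [schemeLHS_zero_deriv P _ _ hY0, schemeRHS_congr hY0] at h1
  have h2 := schemeLHS_eq P ⟨X t, hmem t ht⟩ 0 Y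
  rw [massForm_hat P _ hY, zero_add] at h2
  rw [← h2]
  refine h1.trans ?_
  simp [schemeRHS, volSum]

/-- Volume regularity lifts to the whole field, because eliminated fields are determined by their
volume components. -/
theorem IsReducedSolution.exists_isEvolution (hd : 2 ≤ d) (hΩ : IsOpen Ω) (hT : 0 < T)
    {D : Data Ω T} {X : ℝ → HDGField M} (hX : IsReducedSolution P k D X) :
    ∃ x x' : ℝ → elimSpace M k P, IsEvolution P k hΩ D x x' ∧
      ∀ t ∈ Icc 0 T, (x t).1.1 = X t := by
  classical
  obtain ⟨hmem, ⟨X', hvol, heq⟩, hinit⟩ := hX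
  let x : ℝ → elimSpace M k P := fun t => if ht : t ∈ Icc 0 T then
    ⟨⟨X t, (hmem t ht).1⟩, (mem_elimSpace_iff P hd _).2 (hmem t ht).2⟩ else 0
  have hx : ∀ t ∈ Icc 0 T, (x t).1.1 = X t := fun t ht => by
    simp only [x, dif_pos ht]
  obtain ⟨x', hx', hval⟩ := exists_isC1Curve (x := x) (elimSpace_separating P hd) hT
    (f' := fun v t => volEval v (X' t)) (fun v => by
      have hv := isC1Volume_iff.1 hvol v
      have hxv : ∀ t ∈ Icc 0 T, volEval v (x t).1.1 = volEval v (X t) := fun t ht => by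
        rw [hx t ht]
      exact ⟨hv.1, fun t ht => (hv.2 t ht).congr hxv (hxv t ht)⟩)
  have h0 : (0 : ℝ) ∈ Icc 0 T := ⟨le_rfl, hT.le⟩
  refine ⟨x, x', ⟨hx', fun t ht y => ?_, by rw [hx 0 h0]; exact hinit⟩, hx⟩
  -- the volume part of the test field is admissible in the reduced scheme
  let Y : HDGField M := { y.1.1 with velHat := 0 }
  have hY : Y.MemSpace k :=
    { y.1.2 with
      velHat := fun F _ _ => (M.facePoly (k + 1) F.1).zero_mem
      velHat_boundary := fun _ _ => rfl }
  have hvolY : VolEq Y y.1.1 := ⟨rfl, rfl, rfl, rfl⟩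
  have hvolX' : VolEq (X' t) (x' t).1.1 := volEq_of_volEval fun v => (hval v t ht).symm
  have h1 := heq t ht Y hY rfl
  rw [schemeLHS_congr P hvolX', ← hx t ht, schemeRHS_congr hvolY] at h1
  have h2 := schemeLHS_congr_test P (X' := (x' t).1) (Y := ⟨Y, hY⟩) (x t).2 hvolY
  exact (schemeLHS_eq P (x t).1 (x' t).1 y.1).symm.trans (h2.symm.trans h1)

/-- A test field differs from an eliminated one by a pure face field, against which the scheme holds
because the trial field is eliminated. -/
theorem IsEvolution.isSolution (hd : 2 ≤ d) {hΩ : IsOpen Ω} (hT : 0 ≤ T) {D : Data Ω T}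
    {x x' : ℝ → elimSpace M k P} (hx : IsEvolution P k hΩ D x x') {X : ℝ → HDGField M}
    (hX : ∀ t ∈ Icc 0 T, (x t).1.1 = X t) : IsSolution P k D X := by
  have hC1 : ∀ φ : HDGField M →ₗ[ℝ] ℝ, IsC1 T (fun t => φ (X t)) (fun t => φ (x' t).1.1) :=
    fun φ => by
      have h := hx.isC1 (φ ∘ₗ (space M k).subtype ∘ₗ (elimSpace M k P).subtype)
      have hφ : ∀ t ∈ Icc 0 T, φ (X t) = φ (x t).1.1 := fun t ht => by rw [hX t ht]
      exact ⟨h.1, fun t ht => (h.2 t ht).congr hφ (hφ t ht)⟩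
  refine ⟨fun t ht => hX t ht ▸ (x t).1.2, ⟨fun t => (x' t).1.1,
    isC1Volume_iff.2 fun v => hC1 (volEval v), fun F j y i =>
      hC1 ⟨⟨fun X => X.velHat F j y i, fun _ _ => rfl⟩, fun _ _ => rfl⟩, fun t ht Y hY => ?_⟩,
    hX 0 ⟨le_rfl, hT⟩ ▸ hx.init⟩
  obtain ⟨Z, hZ, hYZ⟩ := exists_elimSpace_sub_mem P hd ⟨Y, hY⟩
  have hvol := volEq_iff_sub_mem.2 hYZ
  rw [← hX t ht]
  have h1 := schemeLHS_congr_test P (X' := (x' t).1) (x t).2 hvol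
  have h2 := hx.eq t ht ⟨Z, hZ⟩
  refine h1.trans ((schemeLHS_eq P (x t).1 (x' t).1 Z).trans (h2.trans ?_))
  exact (schemeRHS_congr hvol).symm

theorem isSolution_iff_isReducedSolution (hd : 2 ≤ d) (hΩ : IsOpen Ω) (hT : 0 < T) {D : Data Ω T}
    (X : ℝ → HDGField M) : IsSolution P k D X ↔ IsReducedSolution P k D X := by
  refine ⟨fun hX => hX.isReducedSolution P hd, fun hX => ?_⟩
  obtain ⟨x, x', hx, hxX⟩ := hX.exists_isEvolution P hd hΩ hT
  exact hx.isSolution P hd hT.le hxX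

/-- The evolution starts from the eliminated field with the projected volume components. -/
theorem exists_solution (hd : 2 ≤ d) (hΩ : IsOpen Ω) (hT : 0 < T) (D : Data Ω T) :
    ∃ X : ℝ → HDGField M, IsSolution P k D X := by
  obtain ⟨X₀, hX₀⟩ := exists_isVolumeInit M k hΩ D
  obtain ⟨Z, hZ, hXZ⟩ := exists_elimSpace_sub_mem P hd X₀
  obtain ⟨x, x', hC1, h0, heq⟩ := exists_evolution (elimMass M k P) (elimSteady M k P) hT.le
    (φ := fun t => (load hΩ D t).domRestrict (elimSpace M k P))
    (fun y => continuousOn_schemeRHS hΩ D y.1) ⟨Z, hZ⟩ (elimMass_definite P hd hΩ)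
  have hx : IsEvolution P k hΩ D x x' := ⟨hC1, heq, by
    rw [h0]
    exact isVolumeInit_congr (volEq_iff_sub_mem.2 hXZ) hX₀⟩
  exact ⟨fun t => (x t).1.1, hx.isSolution P hd hT.le fun _ _ => rfl⟩

theorem solution_unique (hd : 2 ≤ d) (hΩ : IsOpen Ω) (hT : 0 < T) {D : Data Ω T}
    {X Y : ℝ → HDGField M} (hX : IsSolution P k D X) (hY : IsSolution P k D Y) :
    EqOn X Y (Icc 0 T) := by
  obtain ⟨x, x', hx, hxX⟩ := (hX.isReducedSolution P hd).exists_isEvolution P hd hΩ hT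
  obtain ⟨y, y', hy, hyY⟩ := (hY.isReducedSolution P hd).exists_isEvolution P hd hΩ hT
  intro t ht
  rw [← hxX t ht, ← hyY t ht, evolution_unique _ _ (elimMass_definite P hd hΩ) hx.isC1 hy.isC1
    hx.eq hy.eq (elimSpace_eq_of_volEq P hd (isVolumeInit_unique hΩ hx.init hy.init)) t ht]

/-- Since the initial face columns are determined by elimination, they can be prescribed only
consistently. -/
theorem exists_solution_isFaceInit_iff (hd : 2 ≤ d) (hΩ : IsOpen Ω) (hT : 0 < T) (D : Data Ω T)
    (w : M.faces → Fin 3 → Pt d → Pt d) :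
    (∃ X : ℝ → HDGField M, IsSolution P k D X ∧ IsFaceInit k w (X 0)) ↔
      ∃ Y : HDGField M, Y.MemSpace k ∧ IsVolumeInit k D Y ∧ IsFaceInit k w Y ∧
        IsEliminated P k Y := by
  have h0 : (0 : ℝ) ∈ Icc 0 T := ⟨le_rfl, hT.le⟩
  constructor
  · rintro ⟨X, hX, hw⟩
    obtain ⟨h1, h2⟩ := (hX.isReducedSolution P hd).1 0 h0
    exact ⟨X 0, h1, hX.2.2, hw, h2⟩
  · rintro ⟨Y, hY, hinit, hw, helim⟩
    obtain ⟨X, hX⟩ := exists_solution (M := M) (k := k) P hd hΩ hT D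
    obtain ⟨h1, h2⟩ := (hX.isReducedSolution P hd).1 0 h0
    have heq := elimSpace_eq_of_volEq P hd
      (X := ⟨⟨X 0, h1⟩, (mem_elimSpace_iff P hd _).2 h2⟩)
      (Y := ⟨⟨Y, hY⟩, (mem_elimSpace_iff P hd _).2 helim⟩)
      (isVolumeInit_unique hΩ hX.2.2 hinit)
    have hXY : X 0 = Y := congrArg (fun z => z.1.1) heq
    exact ⟨X, hX, hXY ▸ hw⟩

variable (M k) in
theorem exists_solution_bound (hd : 2 ≤ d) (hΩ : IsOpen Ω) (hT : 0 < T) :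
    ∃ C : ℝ, ∀ (D : Data Ω T) (X : ℝ → HDGField M) (m : ℝ), IsSolution P k D X →
      (∀ s ∈ Icc 0 T, (∀ j, ‖D.F s j‖ ≤ m) ∧ ‖D.g s‖ ≤ m) →
      ∀ t ∈ Icc 0 T, innerH1 P (X t) (X t) + innerH2 P (X t) (X t) ≤
        C * (initSize D + m ^ 2) := by
  choose β hβ using fun Y : elimSpace M k P => exists_schemeRHS_bound hΩ T Y.1
  choose κ hκ hκb using exists_volEval_bound (M := M) hΩ T k
  choose c hc using exists_eq_sum_of_separating (elimSpace_separating (M := M) (k := k) P hd)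
  obtain ⟨C₁, hC₁, hbound⟩ := exists_evolution_bound (elimMass M k P) (elimSteady M k P)
    (elimMass_definite P hd hΩ) T β (fun ψ => ∑ v ∈ (c ψ).support, |c ψ v| * κ v)
  obtain ⟨C₂, hC₂, hform⟩ := exists_form_bound (elimMass M k P)
  refine ⟨C₂ * (C₁ ^ 2 * 2), fun D X μ hX hμ t ht => ?_⟩
  obtain ⟨x, x', hx, hxX⟩ := (hX.isReducedSolution P hd).exists_isEvolution P hd hΩ hT
  have hμ0 : 0 ≤ μ := (norm_nonneg _).trans (hμ 0 ⟨le_rfl, hT.le⟩).2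
  have hS : 0 ≤ initSize D := by simp only [initSize]; positivity
  have h1 := hbound (fun t => (load hΩ D t).domRestrict (elimSpace M k P)) x x' μ
    (√(initSize D)) hμ0 (Real.sqrt_nonneg _) hx.isC1 hx.eq
    (fun s hs y => hβ y D s μ (hμ s hs).1 (hμ s hs).2)
    (fun ψ => by
      rw [hc, Finset.sum_mul]
      refine (Finset.abs_sum_le_sum_abs _ _).trans (Finset.sum_le_sum fun v _ => ?_)
      rw [abs_mul, mul_assoc]
      exact mul_le_mul_of_nonneg_left (hκb v D _ hx.init) (abs_nonneg _)) t ht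
  have h2 := hform (x t)
  rw [← hxX t ht]
  calc elimMass M k P (x t) (x t)
      ≤ C₂ * ‖(Module.finBasis ℝ (elimSpace M k P)).equivFun (x t)‖ ^ 2 := h2
    _ ≤ C₂ * (C₁ * (√(initSize D) + μ)) ^ 2 := by gcongr
    _ = C₂ * (C₁ ^ 2 * (√(initSize D) + μ) ^ 2) := by ring
    _ ≤ C₂ * (C₁ ^ 2 * (2 * (√(initSize D) ^ 2 + μ ^ 2))) := by
        gcongr
        exact add_sq_le
    _ = _ := by rw [Real.sq_sqrt hS]; ring

end Scheme

end ThermoHDG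

open ThermoHDG in
theorem mainTheorem5 {d : ℕ} (hd : d = 2 ∨ d = 3) {Ω : Set (Pt d)} (hΩ : IsOpen Ω)
    (M : Mesh Ω) (P : Params d) (k : ℕ) {T : ℝ} (hT : 0 < T) :
    (∀ D : Data Ω T,
      (∃ X : ℝ → HDGField M, IsSolution P k D X) ∧
      (∀ X Y : ℝ → HDGField M, IsSolution P k D X → IsSolution P k D Y →
        Set.EqOn X Y (Set.Icc 0 T)) ∧
      (∀ X : ℝ → HDGField M, IsSolution P k D X ↔ IsReducedSolution P k D X) ∧
      (∀ w : M.faces → Fin 3 → Pt d → Pt d,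
        (∀ F j, MeasureTheory.MemLp (w F j) 2 ((surf d).restrict F.1)) →
        ((∃ X : ℝ → HDGField M, IsSolution P k D X ∧ IsFaceInit k w (X 0)) ↔
          ∃ Y : HDGField M, Y.MemSpace k ∧ IsVolumeInit k D Y ∧ IsFaceInit k w Y ∧
            IsEliminated P k Y))) ∧
    ∃ C : ℝ, ∀ (D : Data Ω T) (X : ℝ → HDGField M) (m : ℝ), IsSolution P k D X →
      (∀ s ∈ Set.Icc 0 T, (∀ j, ‖D.F s j‖ ≤ m) ∧ ‖D.g s‖ ≤ m) →
      ∀ t ∈ Set.Icc 0 T, innerH1 P (X t) (X t) + innerH2 P (X t) (X t) ≤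
        C * ((∑ j, ‖D.vel0 j‖ ^ 2) + (∑ i, ∑ j, ‖D.stress0 i j‖ ^ 2)
          + ‖D.pres0‖ ^ 2 + ‖D.temp0‖ ^ 2 + m ^ 2) := by
  have hd2 : 2 ≤ d := by omega
  exact ⟨fun D => ⟨exists_solution P hd2 hΩ hT D,
    fun _ _ hX hY => solution_unique P hd2 hΩ hT hX hY,
    isSolution_iff_isReducedSolution P hd2 hΩ hT,
    fun w _ => exists_solution_isFaceInit_iff P hd2 hΩ hT D w⟩,
    exists_solution_bound M k P hd2 hΩ hT⟩
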